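/- Let $\mathcal S,\mathcal X,\mathcal Y_1,\mathcal Y_2,\hat{\mathcal S}_1,\hat{\mathcal S}_2$ be finite alphabets with $\mathcal X\neq\emptyset$, let $p_S$ be a probability distribution on $\mathcal S$, let $p_{Y_1,Y_2|X}$ be a discrete memoryless broadcast channel from $\mathcal X$ to $\mathcal Y_1\times\mathcal Y_2$, let $w_i:\mathcal S\times\hat{\mathcal S}_i\to[0,\infty)$ ($i=1,2$) be distortion measures, and let $\kappa,d_1,d_2\in\mathbb R$. The pair $(d_1,d_2)$ is called achievable under $w_1,w_2$ subject to bandwidth expansion constraint $\kappa$ if for every $\epsilon>0$ there are integers $m\ge 1$ and $n\ge 0$ with $n/m\le\kappa+\epsilon$, an encoder $f:\mathcal S^m\to\mathcal X^n$ and decoders $g_i:\mathcal Y_i^n\to\hat{\mathcal S}_i^m$ such that $$\frac1m\sum_{t=1}^m\mathbb E\big[w_i(S(t),\hat S_i(t))\big]\le d_i+\epsilon,\qquad i=1,2,$$ where $S(1),\dots,S(m)$ are i.i.d. with distribution $p_S$, $X^n=f(S^m)$, the pair $(Y_1^n,Y_2^n)$ is the output of $n$ memoryless uses of $p_{Y_1,Y_2|X}$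 with input $X^n$, and $\hat S_i^m=g_i(Y_i^n)$. For a distribution $p_X$ on a finite alphabet and a broadcast channel $p_{Y_1,Y_2|X}$ with finite alphabets, let $\mathcal C_{\mathsf{out}}(p_X,p_{Y_1,Y_2|X})$ be the set of all $(R_0,R_1,R_2)\in\mathbb R^3$ with $R_0,R_1,R_2\ge 0$ for which there are random variables $V_0,V_1,V_2$ with finite alphabets and joint distribution $p_{V_0,V_1,V_2|X}\,p_X\,p_{Y_1,Y_2|X}$ such that, with $I_0=\min\{I(V_0;Y_1),I(V_0;Y_2)\}$, $$\begin{aligned} R_0&\le I_0,\\ R_0+R_i&\le I_0+I(V_i;Y_i|V_0),\quad i=1,2,\\ R_0+R_1+R_2&\le I_0+I(V_1;Y_1|V_0)+I(X;Y_2|V_0,V_1),\\ R_0+R_1+R_2&\le I_0+I(V_2;Y_2|V_0)+I(X;Y_1|V_0,V_2). \end{aligned}$$ If $(d_1,d_2)$ is achievable under $w_1,w_2$ subject to bandwidth expansion constraint $\kappa$, then there exist a conditional distribution (virtual broadcast channel) $p_{\hat S_1,\hat S_2|S}$ from $\mathcal S$ to $\hat{\mathcal S}_1\times\hat{\mathcal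 S}_2$ with $\mathbb E[w_i(S,\hat S_i)]\le d_i$ for $i=1,2$ (where $(S,\hat S_1,\hat S_2)$ has distribution $p_S\,p_{\hat S_1,\hat S_2|S}$) and a probability distribution $p_X$ on $\mathcal X$ such that $$\mathcal C_{\mathsf{out}}(p_S,p_{\hat S_1,\hat S_2|S})\subseteq\kappa\,\mathcal C_{\mathsf{out}}(p_X,p_{Y_1,Y_2|X}),$$ where $\kappa\,\mathcal C=\{\kappa r: r\in\mathcal C\}$. -/

import Mathlib

open scoped BigOperators NNReal Pointwise

noncomputable section

namespace LossyBroadcast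

/-- Probability distributions (probability mass functions) on a finite alphabet. -/
abbrev ProbDist (α : Type*) [Fintype α] : Type _ := stdSimplex ℝ α

/-- Conditional distributions on a finite alphabet `β` given a letter of `α`. -/
abbrev CondDist (α β : Type*) [Fintype β] : Type _ := α → ProbDist β

section Information

variable {Ω α β γ : Type*} [Fintype Ω] [Fintype α] [Fintype β] [Fintype γ]

open Classical in
/-- The probability mass function of the random variable `A`, where `P` is a probability mass
function on the finite sample space `Ω`. -/
def law (P : Ω → ℝ) (A : Ω → α) (a : α) : ℝ := ∑ ω with A ω = a, P ω

/-- Mutual information `I(A;B)` (in nats) under `P`. -/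
def mutualInfo (P : Ω → ℝ) (A : Ω → α) (B : Ω → β) : ℝ :=
  ∑ a, ∑ b, law P (fun ω => (A ω, B ω)) (a, b) *
    Real.log (law P (fun ω => (A ω, B ω)) (a, b) / (law P A a * law P B b))

/-- Conditional mutual information `I(A;B|C)` (in nats) under `P`:
the sum of `p(a,b,c) log (p(a,b,c) p(c) / (p(a,c) p(b,c)))`. -/
def condMutualInfo (P : Ω → ℝ) (A : Ω → α) (B : Ω → β) (C : Ω → γ) : ℝ :=
  ∑ a, ∑ b, ∑ c, law P (fun ω => (A ω, B ω, C ω)) (a, b, c) *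
    Real.log (law P (fun ω => (A ω, B ω, C ω)) (a, b, c) * law P C c /
      (law P (fun ω => (A ω, C ω)) (a, c) * law P (fun ω => (B ω, C ω)) (b, c)))

end Information

section Achievability

variable {S X Y₁ Y₂ T₁ T₂ : Type*} [Fintype S] [Fintype X] [Fintype Y₁] [Fintype Y₂]

/-- The joint probability mass function of a block of `m` i.i.d. source letters and of the
pair of output blocks produced by `n` uses of the memoryless broadcast channel `W` when the
channel input block is `f` of the source block. -/
def blockLaw {m n : ℕ} (pS : ProbDist S) (W : CondDist X (Y₁ × Y₂))
    (f : (Fin m → S) → (Fin n → X)) (ω : (Fin m → S) × (Fin n → Y₁) × (Fin n → Y₂)) : ℝ :=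
  (∏ t, pS (ω.1 t)) * ∏ q, W (f ω.1 q) (ω.2.1 q, ω.2.2 q)

/-- The distortion pair `(d₁, d₂)` is achievable for the source `pS` over the broadcast
channel `W` under the distortion measures `w₁`, `w₂` subject to bandwidth expansion
constraint `κ`. Here `n` is the number of channel uses, so `n / m` is the bandwidth expansion
ratio. -/
def Achievable (pS : ProbDist S) (W : CondDist X (Y₁ × Y₂))
    (w₁ : S → T₁ → ℝ≥0) (w₂ : S → T₂ → ℝ≥0) (κ d₁ d₂ : ℝ) : Prop :=
  ∀ ε : ℝ, 0 < ε → ∃ (m n : ℕ) (f : (Fin m → S) → (Fin n → X))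
    (g₁ : (Fin n → Y₁) → (Fin m → T₁)) (g₂ : (Fin n → Y₂) → (Fin m → T₂)),
    0 < m ∧ (n : ℝ) / (m : ℝ) ≤ κ + ε ∧
    (1 / (m : ℝ)) * ∑ t, ∑ ω, blockLaw pS W f ω * (w₁ (ω.1 t) (g₁ ω.2.1 t) : ℝ) ≤ d₁ + ε ∧
    (1 / (m : ℝ)) * ∑ t, ∑ ω, blockLaw pS W f ω * (w₂ (ω.1 t) (g₂ ω.2.2 t) : ℝ) ≤ d₂ + ε

end Achievability

section OuterBound

variable {X Y₁ Y₂ V₀ V₁ V₂ : Type*} [Fintype X] [Fintype Y₁] [Fintype Y₂]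
  [Fintype V₀] [Fintype V₁] [Fintype V₂]

/-- The joint probability mass function `q(v₀,v₁,v₂|x) pX(x) W(y₁,y₂|x)` of
`((V₀,V₁,V₂),X,(Y₁,Y₂))`. -/
def testLaw (q : CondDist X (V₀ × V₁ × V₂)) (pX : ProbDist X) (W : CondDist X (Y₁ × Y₂))
    (ω : (V₀ × V₁ × V₂) × X × (Y₁ × Y₂)) : ℝ :=
  q ω.2.1 ω.1 * pX ω.2.1 * W ω.2.1 ω.2.2

/-- The rate triples `(R₀,R₁,R₂)` with nonnegative entries that satisfy the outer-bound
inequalities for the test distribution `q`. -/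
def OuterConstraints (q : CondDist X (V₀ × V₁ × V₂)) (pX : ProbDist X) (W : CondDist X (Y₁ × Y₂))
    (R₀ R₁ R₂ : ℝ) : Prop :=
  let P := testLaw q pX W
  let v₀ := fun ω : (V₀ × V₁ × V₂) × X × (Y₁ × Y₂) => ω.1.1
  let v₁ := fun ω : (V₀ × V₁ × V₂) × X × (Y₁ × Y₂) => ω.1.2.1
  let v₂ := fun ω : (V₀ × V₁ × V₂) × X × (Y₁ × Y₂) => ω.1.2.2
  let x := fun ω : (V₀ × V₁ × V₂) × X × (Y₁ × Y₂) => ω.2.1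
  let y₁ := fun ω : (V₀ × V₁ × V₂) × X × (Y₁ × Y₂) => ω.2.2.1
  let y₂ := fun ω : (V₀ × V₁ × V₂) × X × (Y₁ × Y₂) => ω.2.2.2
  let I₀ := min (mutualInfo P v₀ y₁) (mutualInfo P v₀ y₂)
  0 ≤ R₀ ∧ 0 ≤ R₁ ∧ 0 ≤ R₂ ∧
  R₀ ≤ I₀ ∧
  R₀ + R₁ ≤ I₀ + condMutualInfo P v₁ y₁ v₀ ∧
  R₀ + R₂ ≤ I₀ + condMutualInfo P v₂ y₂ v₀ ∧
  R₀ + R₁ + R₂ ≤ I₀ + condMutualInfo P v₁ y₁ v₀ +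
    condMutualInfo P x y₂ (fun ω => (v₀ ω, v₁ ω)) ∧
  R₀ + R₁ + R₂ ≤ I₀ + condMutualInfo P v₂ y₂ v₀ +
    condMutualInfo P x y₁ (fun ω => (v₀ ω, v₂ ω))

/-- The outer-bound region of the broadcast channel `W` with input distribution `pX`. The
auxiliary variables range over all finite alphabets, which up to relabelling are the types
`Fin k`. -/
def outerRegion (pX : ProbDist X) (W : CondDist X (Y₁ × Y₂)) : Set (ℝ × ℝ × ℝ) :=
  {R | ∃ (k₀ k₁ k₂ : ℕ) (q : CondDist X (Fin k₀ × Fin k₁ × Fin k₂)),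
    OuterConstraints q pX W R.1 R.2.1 R.2.2}

end OuterBound

end LossyBroadcast

end

open LossyBroadcast

open scoped BigOperators NNReal Pointwise

set_option linter.unusedSectionVars false

noncomputable section

/-! Fix a code with block lengths `m`, `n`. Let `Q` be the time-averaged conditional law of the two
reconstruction letters given the source letter, and `pX` the time-averaged input law. The
distortions of `Q` are those of the code. Given a test channel `q` for `Q`, attach auxiliary letters
to each source letter through `q`, independently over time. The source letters with their
auxiliaries are then i.i.d., so `m` times each information quantity of the test law is at most the
same quantity for auxiliary blocks and channel output blocks (`condMutualInfo_timeLaw_le`,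
`IsVirtualChannel.mul_testBounds_le`).

The block quantities are single-letterized by Csiszár's sum identity (`infoBounds_chanLaw_le`): the
common auxiliary at time `q` is the common block with the past outputs of receiver 1 and the future
outputs of receiver 2. Averaging over time bounds each right-hand side for `Q` by `n / m` times one
for `pX` (`exists_virtualChannel_bounds`). Neither `Q` nor `pX` depends on the test channel, which
gives an inclusion of regions.

It remains to let the slack tend to zero, but the channel auxiliaries live on alphabets growing with
the block length. The bounds depend on them only through the input law and a few conditional output
entropies. These data range over a set `auxHull` that is compact by Carathéodory's theorem, and
every point of it comes from finite auxiliaries (`exists_testBounds_eq`). Limits of `Q`, `pX` and of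
the hull points along one ultrafilter finish the proof. -/

namespace LossyBroadcast

/-! ### Initial and final segments of blocks. -/

section Blocks

variable {Ω α : Type*}

/-- The initial segment of length `t` of a block of random variables. -/
def prefixVar {n : ℕ} (t : ℕ) (A : Fin n → Ω → α) (ω : Ω) (j : {j : Fin n // (j : ℕ) < t}) : α :=
  A j ω

/-- The final segment, from position `t` on, of a block of random variables. -/
def suffixVar {n : ℕ} (t : ℕ) (A : Fin n → Ω → α) (ω : Ω) (j : {j : Fin n // t ≤ (j : ℕ)}) : α :=
  A j ω

theorem prefixVar_eq_iff {n : ℕ} (t : ℕ) (A : Fin n → Ω → α) (ω ω' : Ω) :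
    prefixVar t A ω = prefixVar t A ω' ↔ ∀ j : Fin n, (j : ℕ) < t → A j ω = A j ω' := by
  simp [funext_iff, prefixVar]

theorem suffixVar_eq_iff {n : ℕ} (t : ℕ) (A : Fin n → Ω → α) (ω ω' : Ω) :
    suffixVar t A ω = suffixVar t A ω' ↔ ∀ j : Fin n, t ≤ (j : ℕ) → A j ω = A j ω' := by
  simp [funext_iff, suffixVar]

theorem prefixVar_succ_eq_iff {n : ℕ} (q : Fin n) (A : Fin n → Ω → α) (ω ω' : Ω) :
    prefixVar (q + 1) A ω = prefixVar (q + 1) A ω' ↔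
      A q ω = A q ω' ∧ prefixVar q A ω = prefixVar q A ω' := by
  simp only [prefixVar_eq_iff]
  refine ⟨fun h => ⟨h q (by omega), fun j hj => h j (by omega)⟩, fun h j hj => ?_⟩
  rcases Nat.lt_succ_iff_lt_or_eq.1 hj with h' | h'
  · exact h.2 j h'
  · rw [Fin.ext h']; exact h.1

theorem suffixVar_eq_succ_iff {n : ℕ} (q : Fin n) (A : Fin n → Ω → α) (ω ω' : Ω) :
    suffixVar q A ω = suffixVar q A ω' ↔
      A q ω = A q ω' ∧ suffixVar (q + 1) A ω = suffixVar (q + 1) A ω' := by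
  simp only [suffixVar_eq_iff]
  refine ⟨fun h => ⟨h q le_rfl, fun j hj => h j (by omega)⟩, fun h j hj => ?_⟩
  rcases hj.eq_or_lt with h' | h'
  · rw [← Fin.ext h']; exact h.1
  · exact h.2 j h'

end Blocks

/-! ### Entropy and information for finite, possibly unnormalised, mass functions. -/

section Entropy

variable {Ω α β γ δ : Type*} [Fintype Ω]

open Classical in
theorem law_eq_sum_ite (P : Ω → ℝ) (A : Ω → α) (a : α) :
    law P A a = ∑ ω, if A ω = a then P ω else 0 := by
  rw [law, Finset.sum_filter]

theorem law_nonneg {P : Ω → ℝ} (hP : ∀ ω, 0 ≤ P ω) (A : Ω → α) (a : α) : 0 ≤ law P A a :=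
  Finset.sum_nonneg fun ω _ => hP ω

theorem law_eq_of_iff (P : Ω → ℝ) {A : Ω → α} {B : Ω → β} {a : α} {b : β}
    (h : ∀ ω, A ω = a ↔ B ω = b) : law P A a = law P B b := by
  classical
  simp only [law_eq_sum_ite, h]

theorem le_law_apply {P : Ω → ℝ} (hP : ∀ ω, 0 ≤ P ω) (A : Ω → α) (ω : Ω) :
    P ω ≤ law P A (A ω) := by
  classical
  exact Finset.single_le_sum (f := P) (fun ω _ => hP ω) (by simp)

theorem law_smul (c : ℝ) (P : Ω → ℝ) (A : Ω → α) (a : α) :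
    law (fun ω => c * P ω) A a = c * law P A a := by
  rw [law, law, Finset.mul_sum]

variable [Fintype α] [Fintype β] [Fintype γ] [Fintype δ]

theorem sum_law_mul (P : Ω → ℝ) (A : Ω → α) (F : α → ℝ) :
    ∑ a, law P A a * F a = ∑ ω, P ω * F (A ω) := by
  classical
  simp only [law_eq_sum_ite, Finset.sum_mul]
  rw [Finset.sum_comm]
  refine Finset.sum_congr rfl fun ω _ => ?_
  simp [ite_mul]

theorem sum_law (P : Ω → ℝ) (A : Ω → α) : ∑ a, law P A a = ∑ ω, P ω := by
  simpa using sum_law_mul P A fun _ => 1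

theorem law_comp (P : Ω → ℝ) (A : Ω → α) (f : α → β) (b : β) :
    law P (fun ω => f (A ω)) b = law (law P A) f b := by
  classical
  have := sum_law_mul P A fun a => if f a = b then 1 else 0
  simp only [mul_ite, mul_one, mul_zero] at this
  rw [law_eq_sum_ite, law_eq_sum_ite, this]

theorem sum_law_pair_right (P : Ω → ℝ) (A : Ω → α) (B : Ω → β) (a : α) :
    ∑ b, law P (fun ω => (A ω, B ω)) (a, b) = law P A a := by
  classical
  simp only [law_eq_sum_ite, Prod.mk.injEq]
  rw [Finset.sum_comm]
  refine Finset.sum_congr rfl fun ω _ => ?_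
  by_cases h : A ω = a <;> simp [h]

theorem sum_law_pair_left (P : Ω → ℝ) (A : Ω → α) (B : Ω → β) (b : β) :
    ∑ a, law P (fun ω => (A ω, B ω)) (a, b) = law P B b := by
  classical
  simp only [law_eq_sum_ite, Prod.mk.injEq]
  rw [Finset.sum_comm]
  refine Finset.sum_congr rfl fun ω _ => ?_
  by_cases h : B ω = b <;> simp [h]

/-- Shannon entropy (in nats) of `A` under the possibly unnormalised mass function `P`. -/
def ent (P : Ω → ℝ) (A : Ω → α) : ℝ := ∑ a, Real.negMulLog (law P A a)

/-- Conditional entropy of `A` given `C`. -/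
def condEnt (P : Ω → ℝ) (A : Ω → α) (C : Ω → γ) : ℝ := ent P (fun ω => (A ω, C ω)) - ent P C

theorem ent_eq_sum (P : Ω → ℝ) (A : Ω → α) :
    ent P A = -∑ ω, P ω * Real.log (law P A (A ω)) := by
  rw [← sum_law_mul P A fun a => Real.log (law P A a), ← Finset.sum_neg_distrib]
  exact Finset.sum_congr rfl fun a _ => by rw [Real.negMulLog]; ring

/-- Entropy sees only the partition of the sample space induced by a variable. Reordering,
regrouping or duplicating components of a tuple thus becomes a propositional check. -/
theorem ent_congr (P : Ω → ℝ) {A : Ω → α} {B : Ω → β}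
    (h : ∀ ω ω', A ω = A ω' ↔ B ω = B ω') : ent P A = ent P B := by
  rw [ent_eq_sum, ent_eq_sum]
  congr 1
  refine Finset.sum_congr rfl fun ω _ => ?_
  rw [law_eq_of_iff P fun ω' => h ω' ω]

theorem ent_comp (P : Ω → ℝ) (A : Ω → α) (f : α → β) :
    ent P (fun ω => f (A ω)) = ent (law P A) f := by
  simp only [ent, law_comp]

theorem condEnt_comp (P : Ω → ℝ) (Z : Ω → α) (f : α → β) (g : α → γ) :
    condEnt P (fun ω => f (Z ω)) (fun ω => g (Z ω)) = condEnt (law P Z) f g := by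
  simp only [condEnt]
  rw [ent_comp P Z g, ent_comp P Z fun z => (f z, g z)]

theorem condEnt_congr (P : Ω → ℝ) {A : Ω → α} {C : Ω → γ} {B : Ω → β} {D : Ω → δ}
    (h : ∀ ω ω', (A ω, C ω) = (A ω', C ω') ↔ (B ω, D ω) = (B ω', D ω'))
    (h' : ∀ ω ω', C ω = C ω' ↔ D ω = D ω') : condEnt P A C = condEnt P B D := by
  rw [condEnt, condEnt, ent_congr P h, ent_congr P h']

theorem condMutualInfo_eq_ent {P : Ω → ℝ} (hP : ∀ ω, 0 ≤ P ω)
    (A : Ω → α) (B : Ω → β) (C : Ω → γ) :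
    condMutualInfo P A B C = ent P (fun ω => (A ω, C ω)) + ent P (fun ω => (B ω, C ω)) -
      ent P (fun ω => (A ω, B ω, C ω)) - ent P C := by
  have h := sum_law_mul P (fun ω => (A ω, B ω, C ω)) fun x =>
    Real.log (law P (fun ω => (A ω, B ω, C ω)) x * law P C x.2.2 /
      (law P (fun ω => (A ω, C ω)) (x.1, x.2.2) * law P (fun ω => (B ω, C ω)) x.2))
  rw [Fintype.sum_prod_type] at h
  simp only [Fintype.sum_prod_type] at h
  rw [condMutualInfo, h]
  simp only [ent_eq_sum]
  rw [← sub_eq_zero]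
  simp only [sub_neg_eq_add, ← Finset.sum_neg_distrib, ← Finset.sum_add_distrib,
    ← Finset.sum_sub_distrib]
  refine Finset.sum_eq_zero fun ω _ => ?_
  rcases (hP ω).eq_or_lt with h0 | h0
  · simp [← h0]
  have h1 := h0.trans_le (le_law_apply hP (fun ω => (A ω, B ω, C ω)) ω)
  have h2 := h0.trans_le (le_law_apply hP (fun ω => (A ω, C ω)) ω)
  have h3 := h0.trans_le (le_law_apply hP (fun ω => (B ω, C ω)) ω)
  have h4 := h0.trans_le (le_law_apply hP C ω)
  rw [Real.log_div (mul_pos h1 h4).ne' (mul_pos h2 h3).ne', Real.log_mul h1.ne' h4.ne',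
    Real.log_mul h2.ne' h3.ne']
  ring

theorem condMutualInfo_eq_left {P : Ω → ℝ} (hP : ∀ ω, 0 ≤ P ω)
    (A : Ω → α) (B : Ω → β) (C : Ω → γ) :
    condMutualInfo P A B C = condEnt P A C - condEnt P A (fun ω => (B ω, C ω)) := by
  rw [condMutualInfo_eq_ent hP, condEnt, condEnt]
  ring

theorem condMutualInfo_eq_right {P : Ω → ℝ} (hP : ∀ ω, 0 ≤ P ω)
    (A : Ω → α) (B : Ω → β) (C : Ω → γ) :
    condMutualInfo P A B C = condEnt P B C - condEnt P B (fun ω => (A ω, C ω)) := by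
  rw [condMutualInfo_eq_ent hP, condEnt, condEnt,
    ent_congr P (A := fun ω => (B ω, A ω, C ω)) (B := fun ω => (A ω, B ω, C ω))]
  · ring
  · simp only [Prod.mk.injEq]; tauto

theorem mutualInfo_eq_condMutualInfo {P : Ω → ℝ} (h1 : ∑ ω, P ω = 1)
    (A : Ω → α) (B : Ω → β) :
    mutualInfo P A B = condMutualInfo P A B fun _ => () := by
  have hu : ∀ c, law P (fun _ => ()) c = 1 := fun c => by
    rw [law_eq_sum_ite]; simpa using h1
  simp only [mutualInfo, condMutualInfo, Finset.univ_unique, Finset.sum_singleton, hu, mul_one]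
  have e1 : ∀ a b, law P (fun ω => (A ω, B ω, ())) (a, b, ()) = law P (fun ω => (A ω, B ω)) (a, b) :=
    fun a b => law_eq_of_iff P (by simp)
  have e2 : ∀ a, law P (fun ω => (A ω, ())) (a, ()) = law P A a :=
    fun a => law_eq_of_iff P (by simp)
  have e3 : ∀ a, law P (fun ω => (B ω, ())) (a, ()) = law P B a :=
    fun a => law_eq_of_iff P (by simp)
  simp only [PUnit.default_eq_unit, e1, e2, e3]

/-- Apply `1 - 1/x ≤ log x` to each term: the lower bounds are the differences `p(a,b,c) - p(a,c)
p(b,c) / p(c)`, whose sum vanishes. Normalisation plays no role. -/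
theorem condMutualInfo_nonneg {P : Ω → ℝ} (hP : ∀ ω, 0 ≤ P ω)
    (A : Ω → α) (B : Ω → β) (C : Ω → γ) : 0 ≤ condMutualInfo P A B C := by
  have key : ∀ a b c, law P (fun ω => (A ω, B ω, C ω)) (a, b, c) -
      law P (fun ω => (A ω, C ω)) (a, c) * law P (fun ω => (B ω, C ω)) (b, c) / law P C c ≤
      law P (fun ω => (A ω, B ω, C ω)) (a, b, c) *
      Real.log (law P (fun ω => (A ω, B ω, C ω)) (a, b, c) * law P C c /
      (law P (fun ω => (A ω, C ω)) (a, c) * law P (fun ω => (B ω, C ω)) (b, c))) := by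
    intro a b c
    have n1 := law_nonneg hP (fun ω => (A ω, C ω)) (a, c)
    have n2 := law_nonneg hP (fun ω => (B ω, C ω)) (b, c)
    have n3 := law_nonneg hP C c
    have le1 : law P (fun ω => (A ω, B ω, C ω)) (a, b, c) ≤ law P (fun ω => (A ω, C ω)) (a, c) := by
      rw [← sum_law_pair_right P (fun ω => (A ω, C ω)) B, law_eq_of_iff P
        (B := fun ω => ((A ω, C ω), B ω)) (b := ((a, c), b)) (by simp; tauto)]
      exact Finset.single_le_sum (f := fun b => law P (fun ω => ((A ω, C ω), B ω)) ((a, c), b))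
        (fun b _ => law_nonneg hP _ _) (Finset.mem_univ b)
    have le2 : law P (fun ω => (A ω, B ω, C ω)) (a, b, c) ≤ law P (fun ω => (B ω, C ω)) (b, c) := by
      rw [← sum_law_pair_left P A (fun ω => (B ω, C ω))]
      exact Finset.single_le_sum (f := fun a => law P (fun ω => (A ω, B ω, C ω)) (a, b, c))
        (fun b _ => law_nonneg hP _ _) (Finset.mem_univ a)
    have le3 : law P (fun ω => (A ω, C ω)) (a, c) ≤ law P C c := by
      rw [← sum_law_pair_left P A C]
      exact Finset.single_le_sum (f := fun a => law P (fun ω => (A ω, C ω)) (a, c))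
        (fun b _ => law_nonneg hP _ _) (Finset.mem_univ a)
    rcases (law_nonneg hP (fun ω => (A ω, B ω, C ω)) (a, b, c)).eq_or_lt with h0 | h0
    · rw [← h0]
      simp only [zero_sub, zero_mul, Left.neg_nonpos_iff]
      positivity
    have p1 := h0.trans_le le1
    have p2 := h0.trans_le le2
    have p3 := p1.trans_le le3
    have hx := Real.one_sub_inv_le_log_of_pos (x := law P (fun ω => (A ω, B ω, C ω)) (a, b, c) *
      law P C c / (law P (fun ω => (A ω, C ω)) (a, c) * law P (fun ω => (B ω, C ω)) (b, c)))
      (by positivity)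
    refine le_trans (le_of_eq ?_) (mul_le_mul_of_nonneg_left hx h0.le)
    field_simp
  have hsum : ∑ a, ∑ b, ∑ c, (law P (fun ω => (A ω, B ω, C ω)) (a, b, c) -
      law P (fun ω => (A ω, C ω)) (a, c) * law P (fun ω => (B ω, C ω)) (b, c) / law P C c) = 0 := by
    simp only [Finset.sum_sub_distrib]
    rw [sub_eq_zero]
    have t1 : ∑ a, ∑ b, ∑ c, law P (fun ω => (A ω, B ω, C ω)) (a, b, c) = ∑ ω, P ω := by
      rw [← sum_law P (fun ω => (A ω, B ω, C ω))]
      simp only [Fintype.sum_prod_type]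
    rw [t1, ← sum_law P C]
    symm
    calc _ = ∑ c, (∑ a, law P (fun ω => (A ω, C ω)) (a, c)) *
          (∑ b, law P (fun ω => (B ω, C ω)) (b, c)) / law P C c := by
          simp only [Finset.sum_mul_sum, Finset.sum_div]
          rw [Finset.sum_comm]
          simp only [fun b => Finset.sum_comm (s := (Finset.univ : Finset α)) (t := (Finset.univ : Finset γ))
            (f := fun a c => law P (fun ω => (A ω, C ω)) (a, c) * law P (fun ω => (B ω, C ω)) (b, c) / law P C c)]
          rw [Finset.sum_comm]
          exact Finset.sum_congr rfl fun c _ => Finset.sum_comm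
      _ = _ := by
          refine Finset.sum_congr rfl fun c _ => ?_
          rw [sum_law_pair_left, sum_law_pair_left, mul_self_div_self]
  rw [condMutualInfo, ← hsum]
  exact Finset.sum_le_sum fun a _ => Finset.sum_le_sum fun b _ => Finset.sum_le_sum fun c _ =>
    key a b c

theorem condEnt_le_of_determines {P : Ω → ℝ} (hP : ∀ ω, 0 ≤ P ω) (A : Ω → α) {C : Ω → γ}
    {D : Ω → δ} (h : ∀ ω ω', D ω = D ω' → C ω = C ω') : condEnt P A D ≤ condEnt P A C := by
  have h0 := condMutualInfo_nonneg hP A D C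
  rw [condMutualInfo_eq_left hP] at h0
  have : condEnt P A (fun ω => (D ω, C ω)) = condEnt P A D := by
    refine condEnt_congr P (fun ω ω' => ?_) (fun ω ω' => ?_)
    · simp only [Prod.mk.injEq]; have := h ω ω'; tauto
    · simp only [Prod.mk.injEq]; have := h ω ω'; tauto
  linarith

/-- The correction term is the same for every variable, so it cancels in conditional entropies,
which are therefore homogeneous in the mass function. -/
theorem ent_smul (c : ℝ) (P : Ω → ℝ) (A : Ω → α) :
    ent (fun ω => c * P ω) A = c * ent P A + (∑ ω, P ω) * Real.negMulLog c := by
  simp only [ent, law_smul, Real.negMulLog_mul, Finset.sum_add_distrib]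
  rw [← Finset.mul_sum, ← Finset.sum_mul, sum_law]
  ring

theorem condEnt_smul (c : ℝ) (P : Ω → ℝ) (A : Ω → α) (C : Ω → γ) :
    condEnt (fun ω => c * P ω) A C = c * condEnt P A C := by
  simp only [condEnt, ent_smul]
  ring

/-- The chain rule for entropy. -/
theorem sum_condEnt_prefixVar (P : Ω → ℝ) {n : ℕ} (A : Fin n → Ω → α) (D : Ω → δ) :
    ∑ q : Fin n, condEnt P (A q) (fun ω => (prefixVar q A ω, D ω)) =
      condEnt P (fun ω q => A q ω) D := by
  -- Each summand is an increment of `G`, so the sum telescopes.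
  set G : ℕ → ℝ := fun t => ent P fun ω => (prefixVar t A ω, D ω) with hG
  have h : ∀ q : Fin n, condEnt P (A q) (fun ω => (prefixVar q A ω, D ω)) =
      G (q + 1) - G q := fun q => by
    rw [condEnt]
    congr 1
    refine ent_congr P fun ω ω' => ?_
    simp only [Prod.mk.injEq, prefixVar_succ_eq_iff]
    tauto
  simp only [h]
  rw [Fin.sum_univ_eq_sum_range (fun i => G (i + 1) - G i) n, Finset.sum_range_sub, condEnt]
  congr 1
  · refine ent_congr P fun ω ω' => ?_
    simp only [Prod.mk.injEq, prefixVar_eq_iff]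
    simp [funext_iff]
  · refine ent_congr P fun ω ω' => ?_
    simp [prefixVar_eq_iff]

/-- The Csiszár sum identity. -/
theorem sum_condEnt_prefixVar_suffixVar (P : Ω → ℝ) {n : ℕ} (A : Fin n → Ω → α)
    (B : Fin n → Ω → β) (D : Ω → δ) :
    ∑ q : Fin n, condEnt P (A q) (fun ω => (D ω, prefixVar q A ω, suffixVar (q + 1) B ω)) -
      ∑ q : Fin n, condEnt P (B q) (fun ω => (D ω, prefixVar q A ω, suffixVar (q + 1) B ω)) =
      condEnt P (fun ω q => A q ω) D - condEnt P (fun ω q => B q ω) D := by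
  -- The two entropies at time `q` share their conditioning, which cancels. Adding `A q` lengthens
  -- the prefix and adding `B q` lengthens the suffix, so the difference is an increment of `G`.
  set G : ℕ → ℝ := fun t => ent P fun ω => (D ω, prefixVar t A ω, suffixVar t B ω) with hG
  have h : ∀ q : Fin n,
      condEnt P (A q) (fun ω => (D ω, prefixVar q A ω, suffixVar (q + 1) B ω)) -
        condEnt P (B q) (fun ω => (D ω, prefixVar q A ω, suffixVar (q + 1) B ω)) =
      G (q + 1) - G q := fun q => by
    rw [condEnt, condEnt, sub_sub_sub_cancel_right]
    congr 1
    · refine ent_congr P fun ω ω' => ?_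
      simp only [Prod.mk.injEq, prefixVar_succ_eq_iff]
      tauto
    · refine ent_congr P fun ω ω' => ?_
      simp only [Prod.mk.injEq, suffixVar_eq_succ_iff q]
      tauto
  rw [← Finset.sum_sub_distrib]
  simp only [h]
  rw [Fin.sum_univ_eq_sum_range (fun i => G (i + 1) - G i) n, Finset.sum_range_sub, condEnt,
    condEnt, sub_sub_sub_cancel_right]
  congr 1
  · refine ent_congr P fun ω ω' => ?_
    have : ∀ j : Fin n, ¬ n ≤ (j : ℕ) := fun j => by omega
    simp only [Prod.mk.injEq, prefixVar_eq_iff, suffixVar_eq_iff]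
    simp [funext_iff, this, and_comm]
  · refine ent_congr P fun ω ω' => ?_
    simp only [Prod.mk.injEq, prefixVar_eq_iff, suffixVar_eq_iff]
    simp [funext_iff, and_comm]

end Entropy

/-! ### Convex hulls in finite dimension. -/

section Caratheodory

variable {E : Type*} [AddCommGroup E] [Module ℝ E]

/-- Carathéodory's theorem padded with zero weights to an index set depending only on the dimension.
The uniform size is what yields compactness of hulls. -/
theorem exists_fin_of_mem_convexHull [FiniteDimensional ℝ E] {s : Set E} {x : E}
    (hx : x ∈ convexHull ℝ s) :
    ∃ w ∈ stdSimplex ℝ (Fin (Module.finrank ℝ E + 1)),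
      ∃ z : Fin (Module.finrank ℝ E + 1) → E, (∀ i, z i ∈ s) ∧ ∑ i, w i • z i = x := by
  obtain ⟨ι, _, z, w, hzs, hai, hw, hw1, rfl⟩ := eq_pos_convex_span_of_mem_convexHull hx
  have hcard : Fintype.card ι ≤ Fintype.card (Fin (Module.finrank ℝ E + 1)) := by
    rw [Fintype.card_fin]
    exact hai.card_le_finrank_succ.trans (Nat.succ_le_succ (Submodule.finrank_le _))
  obtain ⟨e⟩ := Function.Embedding.nonempty_of_card_le hcard
  obtain ⟨i₀⟩ : Nonempty ι := by
    by_contra h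
    rw [not_nonempty_iff] at h
    simp at hw1
  have hew : ∀ i, Function.extend e w 0 (e i) = w i := fun i => e.injective.extend_apply _ _ _
  have hw0 : ∀ j ∉ Set.range e, Function.extend e w 0 j = 0 := fun j hj =>
    Function.extend_apply' _ _ _ (by simpa using hj)
  refine ⟨Function.extend e w 0, ⟨fun j => ?_, ?_⟩, Function.extend e z fun _ => z i₀, fun j => ?_, ?_⟩
  · by_cases hj : j ∈ Set.range e
    · obtain ⟨i, rfl⟩ := hj
      rw [hew]; exact (hw i).le
    · rw [hw0 j hj]
  · rw [← hw1]
    exact (Fintype.sum_of_injective e e.injective _ _ hw0 fun i => (hew i).symm).symm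
  · by_cases hj : j ∈ Set.range e
    · obtain ⟨i, rfl⟩ := hj
      rw [e.injective.extend_apply]; exact hzs ⟨i, rfl⟩
    · rw [Function.extend_apply' _ _ _ (by simpa using hj)]; exact hzs ⟨i₀, rfl⟩
  · refine (Fintype.sum_of_injective e e.injective _ _ (fun j hj => ?_) fun i => ?_).symm
    · rw [hw0 j hj, zero_smul]
    · rw [hew, e.injective.extend_apply]

theorem isCompact_convexHull_of_finiteDimensional [TopologicalSpace E] [ContinuousAdd E]
    [ContinuousSMul ℝ E] [FiniteDimensional ℝ E] {s : Set E} (hs : IsCompact s) :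
    IsCompact (convexHull ℝ s) := by
  have h : convexHull ℝ s =
      (fun p : (Fin (Module.finrank ℝ E + 1) → ℝ) × (Fin (Module.finrank ℝ E + 1) → E) =>
        ∑ i, p.1 i • p.2 i) '' (stdSimplex ℝ _ ×ˢ Set.univ.pi fun _ => s) := by
    ext x
    constructor
    · intro hx
      obtain ⟨w, hw, z, hz, rfl⟩ := exists_fin_of_mem_convexHull hx
      exact ⟨(w, z), ⟨hw, fun i _ => hz i⟩, rfl⟩
    · rintro ⟨⟨w, z⟩, ⟨hw, hz⟩, rfl⟩
      exact mem_convexHull_of_exists_fintype w z hw.1 hw.2 (fun i => hz i trivial) rfl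
  rw [h]
  refine ((isCompact_stdSimplex ℝ _).prod (isCompact_univ_pi fun _ => hs)).image ?_
  fun_prop

/-- Homogeneous form of membership: `z i` is the unnormalised contribution of an auxiliary value of
probability `w i`, and only its normalisation has to lie in `s`. -/
theorem sum_mem_convexHull_of_inv_smul_mem {ι : Type*} [Fintype ι] {s : Set E} (z : ι → E)
    {w : ι → ℝ} (hw0 : ∀ i, 0 ≤ w i) (hw1 : ∑ i, w i = 1) (h0 : ∀ i, w i = 0 → z i = 0)
    (h : ∀ i, 0 < w i → (w i)⁻¹ • z i ∈ s) : ∑ i, z i ∈ convexHull ℝ s := by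
  classical
  obtain ⟨i₀, hi₀⟩ : ∃ i, 0 < w i := by
    by_contra hc
    push Not at hc
    rw [Finset.sum_eq_zero fun i _ => le_antisymm (hc i) (hw0 i)] at hw1
    exact zero_ne_one hw1
  refine mem_convexHull_of_exists_fintype w
    (fun i => if 0 < w i then (w i)⁻¹ • z i else (w i₀)⁻¹ • z i₀) hw0 hw1 (fun i => ?_) ?_
  · split_ifs with hi
    exacts [h i hi, h i₀ hi₀]
  · refine Finset.sum_congr rfl fun i _ => ?_
    rcases (hw0 i).eq_or_lt with hi | hi
    · rw [h0 i hi.symm, ← hi, zero_smul]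
    · rw [if_pos hi, smul_inv_smul₀ hi.ne']

end Caratheodory

/-! ### Output entropy of a channel as a function of its input mass function. -/

section OutputEntropy

variable {X Y : Type*} [Fintype X] [Fintype Y]

/-- For a (possibly unnormalised) input mass function `r`, the entropy of the output of `k`,
extended homogeneously. -/
def outEnt (k : X → Y → ℝ) (r : X → ℝ) : ℝ :=
  ∑ y, Real.negMulLog (∑ x, r x * k x y) - Real.negMulLog (∑ x, r x)

/-- The entropy of the output of `k` given the input, for the input mass function `p`. -/
def noiseEnt (k : X → Y → ℝ) (p : X → ℝ) : ℝ := ∑ x, p x * ∑ y, Real.negMulLog (k x y)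

/-- The output has the same total mass as the input, so the subtracted `negMulLog` of the total mass
removes the inhomogeneous part of the output entropy. -/
theorem outEnt_smul {k : X → Y → ℝ} (hk : ∀ x, ∑ y, k x y = 1) (c : ℝ) (r : X → ℝ) :
    outEnt k (c • r) = c * outEnt k r := by
  have h : ∑ y, ∑ x, r x * k x y = ∑ x, r x := by
    rw [Finset.sum_comm]
    simp [← Finset.mul_sum, hk]
  simp only [outEnt, Pi.smul_apply, smul_eq_mul, mul_assoc, ← Finset.mul_sum, Real.negMulLog_mul,
    Finset.sum_add_distrib]
  rw [← Finset.sum_mul, h]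
  ring

theorem outEnt_zero {k : X → Y → ℝ} : outEnt k 0 = 0 := by
  simp [outEnt]

theorem continuous_outEnt (k : X → Y → ℝ) : Continuous (outEnt k) := by
  unfold outEnt
  fun_prop

theorem continuous_noiseEnt (k : X → Y → ℝ) : Continuous (noiseEnt k) := by
  unfold noiseEnt
  fun_prop

theorem outEnt_of_mem_stdSimplex (k : X → Y → ℝ) {p : X → ℝ} (hp : p ∈ stdSimplex ℝ X) :
    outEnt k p = ∑ y, Real.negMulLog (∑ x, p x * k x y) := by
  simp [outEnt, hp.2]

theorem concaveOn_outEnt {k : X → Y → ℝ} (hk : ∀ x y, 0 ≤ k x y) :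
    ConcaveOn ℝ (stdSimplex ℝ X) (outEnt k) := by
  refine ⟨convex_stdSimplex ℝ X, fun p hp q hq a b ha hb hab => ?_⟩
  rw [outEnt_of_mem_stdSimplex k hp, outEnt_of_mem_stdSimplex k hq,
    outEnt_of_mem_stdSimplex k (convex_stdSimplex ℝ X hp hq ha hb hab), Finset.smul_sum,
    Finset.smul_sum, ← Finset.sum_add_distrib]
  refine Finset.sum_le_sum fun y _ => ?_
  have h := Real.concaveOn_negMulLog.2 (x := ∑ x, p x * k x y) (y := ∑ x, q x * k x y)
    (Finset.sum_nonneg fun x _ => mul_nonneg (hp.1 x) (hk x y))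
    (Finset.sum_nonneg fun x _ => mul_nonneg (hq.1 x) (hk x y)) ha hb hab
  refine h.trans_eq ?_
  congr 1
  simp only [smul_eq_mul, Finset.mul_sum, ← Finset.sum_add_distrib, Pi.add_apply, Pi.smul_apply]
  exact Finset.sum_congr rfl fun x _ => by ring

end OutputEntropy

/-! ### Auxiliary variables as points of convex hulls. -/

section Hull

variable {X Y₁ Y₂ : Type*} [Fintype X] [Fintype Y₁] [Fintype Y₂]

/-- The pairs of conditional output entropies that an auxiliary variable can produce, together
with the input mass function. -/
def entHull (k₁ : X → Y₁ → ℝ) (k₂ : X → Y₂ → ℝ) : Set ((X → ℝ) × ℝ × ℝ) :=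
  convexHull ℝ ((fun p => (p, outEnt k₁ p, outEnt k₂ p)) '' stdSimplex ℝ X)

/-- The points obtained for a constant common auxiliary variable: input mass function, output
entropies, and the conditional output entropies for two further auxiliary variables. -/
def auxPoints (k₁ : X → Y₁ → ℝ) (k₂ : X → Y₂ → ℝ) :
    Set ((X → ℝ) × (ℝ × ℝ) × (ℝ × ℝ) × (ℝ × ℝ)) :=
  {z | z.2.1 = (outEnt k₁ z.1, outEnt k₂ z.1) ∧ (z.1, z.2.2.1) ∈ entHull k₁ k₂ ∧
    (z.1, z.2.2.2) ∈ entHull k₁ k₂}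

/-- The points obtained for arbitrary finite auxiliary variables. -/
def auxHull (k₁ : X → Y₁ → ℝ) (k₂ : X → Y₂ → ℝ) :
    Set ((X → ℝ) × (ℝ × ℝ) × (ℝ × ℝ) × (ℝ × ℝ)) :=
  convexHull ℝ (auxPoints k₁ k₂)

variable {k₁ : X → Y₁ → ℝ} {k₂ : X → Y₂ → ℝ}

theorem isCompact_entHull : IsCompact (entHull k₁ k₂) := by
  refine isCompact_convexHull_of_finiteDimensional ((isCompact_stdSimplex ℝ X).image ?_)
  have := continuous_outEnt k₁
  have := continuous_outEnt k₂
  fun_prop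

/-- The generating set is a continuous image of the fibre product of two copies of `entHull` over
the common input law. -/
theorem isCompact_auxHull : IsCompact (auxHull k₁ k₂) := by
  refine isCompact_convexHull_of_finiteDimensional ?_
  have hc : IsCompact {w : ((X → ℝ) × ℝ × ℝ) × ((X → ℝ) × ℝ × ℝ) |
      w ∈ entHull k₁ k₂ ×ˢ entHull k₁ k₂ ∧ w.1.1 = w.2.1} :=
    (isCompact_entHull.prod isCompact_entHull).inter_right
      (isClosed_eq (by fun_prop) (by fun_prop))
  have h1 := continuous_outEnt k₁
  have h2 := continuous_outEnt k₂
  convert hc.image (f := fun w => (w.1.1, (outEnt k₁ w.1.1, outEnt k₂ w.1.1), w.1.2, w.2.2))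
    (by fun_prop) using 1
  ext ⟨p, h, a, b⟩
  simp only [auxPoints, Set.mem_ofPred_eq, Set.mem_image, Set.mem_prod, Prod.mk.injEq, Prod.exists]
  constructor
  · rintro ⟨h, ha, hb⟩
    exact ⟨p, a.1, a.2, p, b.1, b.2, ⟨⟨ha, hb⟩, rfl⟩, rfl, h.symm, rfl, rfl⟩
  · rintro ⟨p, a₁, a₂, p', b₁, b₂, ⟨⟨ha, hb⟩, rfl⟩, rfl, h, rfl, rfl⟩
    exact ⟨h.symm, ha, hb⟩

/-- Read `r i` as the joint mass of the auxiliary value `i` and the input. By homogeneity, the sums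
of `outEnt` are averages of output entropies over the auxiliary. -/
theorem mem_entHull_of_sum_eq (hk₁ : ∀ x, ∑ y, k₁ x y = 1) (hk₂ : ∀ x, ∑ y, k₂ x y = 1)
    {ι : Type*} [Fintype ι] {r : ι → X → ℝ} (hr : ∀ i x, 0 ≤ r i x) {p : X → ℝ}
    (hp : p ∈ stdSimplex ℝ X) (h : ∑ i, r i = p) :
    (p, ∑ i, outEnt k₁ (r i), ∑ i, outEnt k₂ (r i)) ∈ entHull k₁ k₂ := by
  have key := sum_mem_convexHull_of_inv_smul_mem
    (s := (fun p => (p, outEnt k₁ p, outEnt k₂ p)) '' stdSimplex ℝ X)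
    (fun i => (r i, outEnt k₁ (r i), outEnt k₂ (r i))) (w := fun i => ∑ x, r i x)
    (fun i => Finset.sum_nonneg fun x _ => hr i x) ?_ ?_ ?_
  · rw [← h]
    convert key using 1
    · rfl
    · simp only [Prod.ext_iff, Prod.fst_sum, Prod.snd_sum, and_self]
  · rw [← hp.2, ← h]
    simp only [Finset.sum_apply]
    exact Finset.sum_comm
  · intro i hi
    have : r i = 0 := by
      ext x
      exact (Finset.sum_eq_zero_iff_of_nonneg fun x _ => hr i x).1 hi x (Finset.mem_univ x)
    simp [this, outEnt_zero]
  · intro i hi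
    refine ⟨(∑ x, r i x)⁻¹ • r i, ⟨fun x => mul_nonneg (inv_nonneg.2 hi.le) (hr i x), ?_⟩, ?_⟩
    · simp only [Pi.smul_apply, smul_eq_mul, ← Finset.mul_sum]
      exact inv_mul_cancel₀ hi.ne'
    · simp [outEnt_smul hk₁, outEnt_smul hk₂]

/-- The two-level version: `u` splits the input by the common auxiliary, and each slice is split
further, once by each private auxiliary. -/
theorem mem_auxHull_of_sum_eq (hk₁ : ∀ x, ∑ y, k₁ x y = 1) (hk₂ : ∀ x, ∑ y, k₂ x y = 1)
    {ι₀ ι₁ ι₂ : Type*} [Fintype ι₀] [Fintype ι₁] [Fintype ι₂]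
    {r₁ : ι₀ → ι₁ → X → ℝ} {r₂ : ι₀ → ι₂ → X → ℝ} {u : ι₀ → X → ℝ}
    (hr₁ : ∀ i j x, 0 ≤ r₁ i j x) (hr₂ : ∀ i j x, 0 ≤ r₂ i j x)
    (h₁ : ∀ i, ∑ j, r₁ i j = u i) (h₂ : ∀ i, ∑ j, r₂ i j = u i) {p : X → ℝ}
    (hp : p ∈ stdSimplex ℝ X) (h : ∑ i, u i = p) :
    (p, (∑ i, outEnt k₁ (u i), ∑ i, outEnt k₂ (u i)),
      (∑ i, ∑ j, outEnt k₁ (r₁ i j), ∑ i, ∑ j, outEnt k₂ (r₁ i j)),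
      (∑ i, ∑ j, outEnt k₁ (r₂ i j), ∑ i, ∑ j, outEnt k₂ (r₂ i j))) ∈ auxHull k₁ k₂ := by
  have hu : ∀ i x, 0 ≤ u i x := fun i x => by
    rw [← h₁, Finset.sum_apply]
    exact Finset.sum_nonneg fun j _ => hr₁ i j x
  have key := sum_mem_convexHull_of_inv_smul_mem (s := auxPoints k₁ k₂)
    (fun i => (u i, (outEnt k₁ (u i), outEnt k₂ (u i)),
      (∑ j, outEnt k₁ (r₁ i j), ∑ j, outEnt k₂ (r₁ i j)),
      (∑ j, outEnt k₁ (r₂ i j), ∑ j, outEnt k₂ (r₂ i j)))) (w := fun i => ∑ x, u i x)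
    (fun i => Finset.sum_nonneg fun x _ => hu i x) ?_ ?_ ?_
  · rw [← h]
    convert key using 1
    · rfl
    · simp only [Prod.ext_iff, Prod.fst_sum, Prod.snd_sum, and_self]
  · rw [← hp.2, ← h]
    simp only [Finset.sum_apply]
    exact Finset.sum_comm
  · intro i hi
    have hui : u i = 0 := by
      ext x
      exact (Finset.sum_eq_zero_iff_of_nonneg fun x _ => hu i x).1 hi x (Finset.mem_univ x)
    have z₁ : ∀ j, r₁ i j = 0 := fun j => by
      ext x
      have := congrFun ((h₁ i).trans hui) x
      rw [Finset.sum_apply] at this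
      exact (Finset.sum_eq_zero_iff_of_nonneg fun j _ => hr₁ i j x).1 this j (Finset.mem_univ j)
    have z₂ : ∀ j, r₂ i j = 0 := fun j => by
      ext x
      have := congrFun ((h₂ i).trans hui) x
      rw [Finset.sum_apply] at this
      exact (Finset.sum_eq_zero_iff_of_nonneg fun j _ => hr₂ i j x).1 this j (Finset.mem_univ j)
    simp [hui, z₁, z₂, outEnt_zero]
  · intro i hi
    have hc := inv_nonneg.2 hi.le
    have hmem : (∑ x, u i x)⁻¹ • u i ∈ stdSimplex ℝ X := by
      refine ⟨fun x => mul_nonneg hc (hu i x), ?_⟩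
      simp only [Pi.smul_apply, smul_eq_mul, ← Finset.mul_sum]
      exact inv_mul_cancel₀ hi.ne'
    refine ⟨?_, ?_, ?_⟩
    · simp [outEnt_smul hk₁, outEnt_smul hk₂]
    · have := mem_entHull_of_sum_eq hk₁ hk₂ (r := fun j => (∑ x, u i x)⁻¹ • r₁ i j)
        (fun j x => mul_nonneg hc (hr₁ i j x)) hmem (by rw [← Finset.smul_sum, h₁])
      simpa [outEnt_smul hk₁, outEnt_smul hk₂, Finset.mul_sum] using this
    · have := mem_entHull_of_sum_eq hk₁ hk₂ (r := fun j => (∑ x, u i x)⁻¹ • r₂ i j)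
        (fun j x => mul_nonneg hc (hr₂ i j x)) hmem (by rw [← Finset.smul_sum, h₂])
      simpa [outEnt_smul hk₁, outEnt_smul hk₂, Finset.mul_sum] using this

theorem exists_of_mem_entHull (hk₁ : ∀ x, ∑ y, k₁ x y = 1) (hk₂ : ∀ x, ∑ y, k₂ x y = 1)
    {z : (X → ℝ) × ℝ × ℝ} (hz : z ∈ entHull k₁ k₂) :
    ∃ r : Fin (Module.finrank ℝ ((X → ℝ) × ℝ × ℝ) + 1) → X → ℝ, (∀ i x, 0 ≤ r i x) ∧
      z = (∑ i, r i, ∑ i, outEnt k₁ (r i), ∑ i, outEnt k₂ (r i)) := by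
  obtain ⟨w, hw, z, hz', rfl⟩ := exists_fin_of_mem_convexHull hz
  choose p hp hpz using hz'
  refine ⟨fun i => w i • p i, fun i x => mul_nonneg (hw.1 i) ((hp i).1 x), ?_⟩
  ext <;> simp [Prod.fst_sum, Prod.snd_sum, ← hpz, outEnt_smul hk₁, outEnt_smul hk₂]

theorem exists_of_mem_auxHull (hk₁ : ∀ x, ∑ y, k₁ x y = 1) (hk₂ : ∀ x, ∑ y, k₂ x y = 1)
    {z : (X → ℝ) × (ℝ × ℝ) × (ℝ × ℝ) × (ℝ × ℝ)} (hz : z ∈ auxHull k₁ k₂) :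
    ∃ (m n : ℕ) (r₁ r₂ : Fin (m + 1) → Fin (n + 1) → X → ℝ) (u : Fin (m + 1) → X → ℝ),
      (∀ i j x, 0 ≤ r₁ i j x) ∧ (∀ i j x, 0 ≤ r₂ i j x) ∧
      (∀ i, ∑ j, r₁ i j = u i) ∧ (∀ i, ∑ j, r₂ i j = u i) ∧
      z = (∑ i, u i, (∑ i, outEnt k₁ (u i), ∑ i, outEnt k₂ (u i)),
        (∑ i, ∑ j, outEnt k₁ (r₁ i j), ∑ i, ∑ j, outEnt k₂ (r₁ i j)),
        (∑ i, ∑ j, outEnt k₁ (r₂ i j), ∑ i, ∑ j, outEnt k₂ (r₂ i j))) := by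
  obtain ⟨w, hw, z, hz', rfl⟩ := exists_fin_of_mem_convexHull hz
  have h₁ := fun i => exists_of_mem_entHull hk₁ hk₂ (hz' i).2.1
  have h₂ := fun i => exists_of_mem_entHull hk₁ hk₂ (hz' i).2.2
  choose r₁ hr₁ hz₁ using h₁
  choose r₂ hr₂ hz₂ using h₂
  simp only [Prod.ext_iff] at hz₁ hz₂
  have hz0 := fun i => Prod.ext_iff.1 (hz' i).1
  refine ⟨_, _, fun i j => w i • r₁ i j, fun i j => w i • r₂ i j, fun i => w i • (z i).1,
    fun i j x => mul_nonneg (hw.1 i) (hr₁ i j x), fun i j x => mul_nonneg (hw.1 i) (hr₂ i j x),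
    fun i => ?_, fun i => ?_, ?_⟩
  · simp only [← Finset.smul_sum, (hz₁ i).1]
  · simp only [← Finset.smul_sum, (hz₂ i).1]
  · ext <;> simp [Prod.fst_sum, Prod.snd_sum, outEnt_smul hk₁, outEnt_smul hk₂, hz0, hz₁, hz₂,
      Finset.mul_sum]

end Hull

/-! ### Markov relations between auxiliaries, channel input and output. -/

section ChannelOutput

variable {Ω υ υ' X Y Y' : Type*} [Fintype Ω] [Fintype υ] [Fintype υ'] [Fintype X] [Fintype Y]
  [Fintype Y']

/-- Under `P`, the variable `B` is the output of the channel `k` with input `A`, independently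
of `U` given `A`. -/
def IsChannelOutput (P : Ω → ℝ) (U : Ω → υ) (A : Ω → X) (B : Ω → Y) (k : X → Y → ℝ) : Prop :=
  ∀ u x y, law P (fun ω => (U ω, A ω, B ω)) (u, x, y) = law P (fun ω => (U ω, A ω)) (u, x) * k x y

theorem IsChannelOutput.comp {P : Ω → ℝ} {U : Ω → υ} {A : Ω → X} {B : Ω → Y} {k : X → Y → ℝ}
    (h : IsChannelOutput P U A B k) (f : υ → υ') (g : Y → Y') :
    IsChannelOutput P (fun ω => f (U ω)) A (fun ω => g (B ω)) fun x => law (k x) g := by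
  classical
  intro u x y
  rw [law_comp P (fun ω => (U ω, A ω, B ω)) fun z => (f z.1, z.2.1, g z.2.2),
    law_comp P (fun ω => (U ω, A ω)) fun z => (f z.1, z.2)]
  simp only [law_eq_sum_ite _ g, law_eq_sum_ite _ fun z : υ × X × Y => (f z.1, z.2.1, g z.2.2),
    law_eq_sum_ite _ fun z : υ × X => (f z.1, z.2)]
  simp only [Fintype.sum_prod_type, Prod.mk.injEq, h _ _ _]
  simp only [ite_and, Finset.sum_mul]
  refine Finset.sum_congr rfl fun v _ => ?_
  by_cases hv : f v = u
  · simp [hv, Finset.sum_ite_eq', Finset.mul_sum]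
    rw [Finset.sum_eq_single x]
    · simp
    · intro b _ hb; simp [hb]
    · simp
  · simp [hv]

/-- Each value of `U` contributes through its slice of the joint mass with the input. This is the
link between random variables and hull points. -/
theorem IsChannelOutput.condEnt_eq {P : Ω → ℝ} {U : Ω → υ} {A : Ω → X} {B : Ω → Y}
    {k : X → Y → ℝ} (h : IsChannelOutput P U A B k) :
    condEnt P B U = ∑ u, outEnt k fun x => law P (fun ω => (U ω, A ω)) (u, x) := by
  have h1 : ∀ u y, law P (fun ω => (B ω, U ω)) (y, u) =
      ∑ x, law P (fun ω => (U ω, A ω)) (u, x) * k x y := fun u y => by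
    simp only [← h u _ y]
    rw [← sum_law_pair_left P A fun ω => (B ω, U ω)]
    exact Finset.sum_congr rfl fun x _ => law_eq_of_iff P (by simp; tauto)
  simp only [condEnt, ent, outEnt, Finset.sum_sub_distrib, sum_law_pair_right,
    Fintype.sum_prod_type, h1]
  rw [Finset.sum_comm]

theorem IsChannelOutput.condEnt_eq_noiseEnt {P : Ω → ℝ} {U : Ω → υ} {A : Ω → X} {B : Ω → Y}
    {k : X → Y → ℝ} (hk : ∀ x, ∑ y, k x y = 1) (h : IsChannelOutput P U A B k) :
    condEnt P B (fun ω => (A ω, U ω)) = noiseEnt k (law P A) := by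
  have e : condEnt P B (fun ω => (A ω, U ω)) = ent P (fun ω => (U ω, A ω, B ω)) -
      ent P (fun ω => (U ω, A ω)) := by
    rw [condEnt]
    congr 1
    · exact ent_congr P (by simp; tauto)
    · exact ent_congr P (by simp; tauto)
  rw [e]
  simp only [ent, Fintype.sum_prod_type, h _ _ _, Real.negMulLog_mul, Finset.sum_add_distrib,
    ← Finset.sum_mul, ← Finset.mul_sum, hk, one_mul, noiseEnt]
  rw [add_sub_cancel_left, Finset.sum_comm]
  simp only [← Finset.sum_mul, sum_law_pair_left]

theorem IsChannelOutput.condEnt_eq_noiseEnt_of_determines {P : Ω → ℝ} {U : Ω → υ} {A : Ω → X}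
    {B : Ω → Y} {k : X → Y → ℝ} (hk : ∀ x, ∑ y, k x y = 1) (h : IsChannelOutput P U A B k)
    (hU : ∀ ω ω', U ω = U ω' → A ω = A ω') : condEnt P B U = noiseEnt k (law P A) := by
  rw [← h.condEnt_eq_noiseEnt hk]
  refine condEnt_congr P (fun ω ω' => ?_) fun ω ω' => ?_
  · simp only [Prod.mk.injEq]; have := hU ω ω'; tauto
  · simp only [Prod.mk.injEq]; have := hU ω ω'; tauto

end ChannelOutput

/-! ### The five right-hand sides in terms of conditional output entropies. -/

section Bounds

/-- The right-hand sides of the five outer-bound inequalities. -/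
def outerBounds (i₁ i₂ j₁ j₂ k₁ k₂ : ℝ) : Fin 5 → ℝ :=
  ![min i₁ i₂, min i₁ i₂ + j₁, min i₁ i₂ + j₂, min i₁ i₂ + j₁ + k₁, min i₁ i₂ + j₂ + k₂]

theorem outerBounds_mono {i₁ i₂ j₁ j₂ k₁ k₂ i₁' i₂' j₁' j₂' k₁' k₂' : ℝ} (hi₁ : i₁ ≤ i₁')
    (hi₂ : i₂ ≤ i₂') (hj₁ : j₁ ≤ j₁') (hj₂ : j₂ ≤ j₂') (hk₁ : k₁ ≤ k₁') (hk₂ : k₂ ≤ k₂')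
    (t : Fin 5) : outerBounds i₁ i₂ j₁ j₂ k₁ k₂ t ≤ outerBounds i₁' i₂' j₁' j₂' k₁' k₂' t := by
  have h := min_le_min hi₁ hi₂
  fin_cases t
  exacts [h, add_le_add h hj₁, add_le_add h hj₂, add_le_add (add_le_add h hj₁) hk₁,
    add_le_add (add_le_add h hj₂) hk₂]

theorem outerBounds_mul {c : ℝ} (hc : 0 ≤ c) (i₁ i₂ j₁ j₂ k₁ k₂ : ℝ) (t : Fin 5) :
    outerBounds (c * i₁) (c * i₂) (c * j₁) (c * j₂) (c * k₁) (c * k₂) t =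
      c * outerBounds i₁ i₂ j₁ j₂ k₁ k₂ t := by
  have := mul_min_of_nonneg i₁ i₂ hc
  fin_cases t <;> simp [outerBounds, ← this] <;> ring

theorem outerBounds_nonneg {i₁ i₂ j₁ j₂ k₁ k₂ : ℝ} (hi₁ : 0 ≤ i₁)
    (hi₂ : 0 ≤ i₂) (hj₁ : 0 ≤ j₁) (hj₂ : 0 ≤ j₂) (hk₁ : 0 ≤ k₁) (hk₂ : 0 ≤ k₂)
    (t : Fin 5) : 0 ≤ outerBounds i₁ i₂ j₁ j₂ k₁ k₂ t := by
  have h := le_min hi₁ hi₂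
  fin_cases t
  exacts [h, add_nonneg h hj₁, add_nonneg h hj₂, add_nonneg (add_nonneg h hj₁) hk₁,
    add_nonneg (add_nonneg h hj₂) hk₂]

variable {Ω A₀ A₁ A₂ N B₁ B₂ : Type*} [Fintype Ω] [Fintype A₀] [Fintype A₁] [Fintype A₂]
  [Fintype N] [Fintype B₁] [Fintype B₂]

/-- The right-hand sides of the outer-bound inequalities for given random variables. -/
def infoBounds (P : Ω → ℝ) (a₀ : Ω → A₀) (a₁ : Ω → A₁) (a₂ : Ω → A₂) (x : Ω → N) (b₁ : Ω → B₁)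
    (b₂ : Ω → B₂) : Fin 5 → ℝ :=
  outerBounds (mutualInfo P a₀ b₁) (mutualInfo P a₀ b₂) (condMutualInfo P a₁ b₁ a₀)
    (condMutualInfo P a₂ b₂ a₀) (condMutualInfo P x b₂ fun ω => (a₀ ω, a₁ ω))
    (condMutualInfo P x b₁ fun ω => (a₀ ω, a₂ ω))

theorem mutualInfo_eq_condEnt {P : Ω → ℝ} (hP : ∀ ω, 0 ≤ P ω) (h1 : ∑ ω, P ω = 1)
    (a : Ω → A₀) (b : Ω → B₁) :
    mutualInfo P a b = condEnt P b (fun _ => ()) - condEnt P b a := by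
  rw [mutualInfo_eq_condMutualInfo h1, condMutualInfo_eq_right hP]
  congr 1
  exact condEnt_congr P (by simp) (by simp)

/-- In this form `a₁` and `a₂` never occur together, and no quotient of probabilities appears. -/
theorem infoBounds_eq {P : Ω → ℝ} (hP : ∀ ω, 0 ≤ P ω) (h1 : ∑ ω, P ω = 1) (a₀ : Ω → A₀)
    (a₁ : Ω → A₁) (a₂ : Ω → A₂) (x : Ω → N) (b₁ : Ω → B₁) (b₂ : Ω → B₂) :
    infoBounds P a₀ a₁ a₂ x b₁ b₂ = outerBounds
      (condEnt P b₁ (fun _ => ()) - condEnt P b₁ a₀) (condEnt P b₂ (fun _ => ()) - condEnt P b₂ a₀)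
      (condEnt P b₁ a₀ - condEnt P b₁ fun ω => (a₀ ω, a₁ ω))
      (condEnt P b₂ a₀ - condEnt P b₂ fun ω => (a₀ ω, a₂ ω))
      ((condEnt P b₂ fun ω => (a₀ ω, a₁ ω)) - condEnt P b₂ fun ω => (x ω, a₀ ω, a₁ ω))
      ((condEnt P b₁ fun ω => (a₀ ω, a₂ ω)) - condEnt P b₁ fun ω => (x ω, a₀ ω, a₂ ω)) := by
  rw [infoBounds, mutualInfo_eq_condEnt hP h1, mutualInfo_eq_condEnt hP h1,
    condMutualInfo_eq_right hP, condMutualInfo_eq_right hP, condMutualInfo_eq_right hP,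
    condMutualInfo_eq_right hP]
  rw [condEnt_congr P (C := fun ω => (a₁ ω, a₀ ω)) (D := fun ω => (a₀ ω, a₁ ω)) (A := b₁) (B := b₁),
    condEnt_congr P (C := fun ω => (a₂ ω, a₀ ω)) (D := fun ω => (a₀ ω, a₂ ω)) (A := b₂) (B := b₂)]
  all_goals simp; try tauto

variable {X Y₁ Y₂ : Type*} [Fintype X] [Fintype Y₁] [Fintype Y₂]

/-- The right-hand sides of the outer-bound inequalities at a point of `auxHull`. -/
def hullBounds (k₁ : X → Y₁ → ℝ) (k₂ : X → Y₂ → ℝ)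
    (z : (X → ℝ) × (ℝ × ℝ) × (ℝ × ℝ) × (ℝ × ℝ)) : Fin 5 → ℝ :=
  outerBounds (outEnt k₁ z.1 - z.2.1.1) (outEnt k₂ z.1 - z.2.1.2) (z.2.1.1 - z.2.2.1.1)
    (z.2.1.2 - z.2.2.2.2) (z.2.2.1.2 - noiseEnt k₂ z.1) (z.2.2.2.1 - noiseEnt k₁ z.1)

theorem continuous_outerBounds (t : Fin 5) :
    Continuous fun v : ℝ × ℝ × ℝ × ℝ × ℝ × ℝ =>
      outerBounds v.1 v.2.1 v.2.2.1 v.2.2.2.1 v.2.2.2.2.1 v.2.2.2.2.2 t := by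
  fin_cases t <;> simp only [outerBounds] <;> simp <;> fun_prop

theorem continuous_hullBounds (k₁ : X → Y₁ → ℝ) (k₂ : X → Y₂ → ℝ) (t : Fin 5) :
    Continuous fun z => hullBounds k₁ k₂ z t := by
  have h1 := continuous_outEnt k₁
  have h2 := continuous_outEnt k₂
  have h3 := continuous_noiseEnt k₁
  have h4 := continuous_noiseEnt k₂
  refine (continuous_outerBounds t).comp (f := fun z : (X → ℝ) × (ℝ × ℝ) × (ℝ × ℝ) × (ℝ × ℝ) =>
    (outEnt k₁ z.1 - z.2.1.1, outEnt k₂ z.1 - z.2.1.2, z.2.1.1 - z.2.2.1.1,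
    z.2.1.2 - z.2.2.2.2, z.2.2.1.2 - noiseEnt k₂ z.1, z.2.2.2.1 - noiseEnt k₁ z.1)) ?_
  fun_prop

theorem IsChannelOutput.condEnt_unit_eq {P : Ω → ℝ} {a : Ω → A₀} {x : Ω → X} {b : Ω → Y₁}
    {k : X → Y₁ → ℝ} (h : IsChannelOutput P a x b k) :
    condEnt P b (fun _ => ()) = outEnt k (law P x) := by
  classical
  have h0 : IsChannelOutput P (fun _ => ()) x b k := by
    have e := h.comp (fun _ => ()) id
    have : (fun x => law (k x) id) = k := by
      ext x y
      simp [law_eq_sum_ite]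
    rw [this] at e
    exact e
  rw [h0.condEnt_eq]
  simp only [Finset.univ_unique, Finset.sum_singleton]
  congr 1
  ext c
  exact law_eq_of_iff P (by simp)

/-- The test law of the auxiliary variables `(a₀, a₁, a₂)`, as a point of the hull. -/
def auxPoint (P : Ω → ℝ) (a₀ : Ω → A₀) (a₁ : Ω → A₁) (a₂ : Ω → A₂) (x : Ω → X) (b₁ : Ω → Y₁)
    (b₂ : Ω → Y₂) : (X → ℝ) × (ℝ × ℝ) × (ℝ × ℝ) × (ℝ × ℝ) :=
  (law P x, (condEnt P b₁ a₀, condEnt P b₂ a₀),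
    (condEnt P b₁ (fun ω => (a₀ ω, a₁ ω)), condEnt P b₂ (fun ω => (a₀ ω, a₁ ω))),
    (condEnt P b₁ (fun ω => (a₀ ω, a₂ ω)), condEnt P b₂ (fun ω => (a₀ ω, a₂ ω))))

theorem auxPoint_mem_auxHull {P : Ω → ℝ} (hP : ∀ ω, 0 ≤ P ω) (h1 : ∑ ω, P ω = 1)
    {a₀ : Ω → A₀} {a₁ : Ω → A₁} {a₂ : Ω → A₂} {x : Ω → X} {b₁ : Ω → Y₁} {b₂ : Ω → Y₂}
    {k₁ : X → Y₁ → ℝ} {k₂ : X → Y₂ → ℝ}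
    (hk₁ : ∀ x, ∑ y, k₁ x y = 1) (hk₂ : ∀ x, ∑ y, k₂ x y = 1)
    (h₀₁ : IsChannelOutput P a₀ x b₁ k₁) (h₀₂ : IsChannelOutput P a₀ x b₂ k₂)
    (h₁₁ : IsChannelOutput P (fun ω => (a₀ ω, a₁ ω)) x b₁ k₁)
    (h₁₂ : IsChannelOutput P (fun ω => (a₀ ω, a₁ ω)) x b₂ k₂)
    (h₂₁ : IsChannelOutput P (fun ω => (a₀ ω, a₂ ω)) x b₁ k₁)
    (h₂₂ : IsChannelOutput P (fun ω => (a₀ ω, a₂ ω)) x b₂ k₂) :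
    auxPoint P a₀ a₁ a₂ x b₁ b₂ ∈ auxHull k₁ k₂ := by
  rw [auxPoint, h₀₁.condEnt_eq, h₀₂.condEnt_eq, h₁₁.condEnt_eq, h₁₂.condEnt_eq, h₂₁.condEnt_eq,
    h₂₂.condEnt_eq]
  simp only [Fintype.sum_prod_type]
  refine mem_auxHull_of_sum_eq hk₁ hk₂ (fun i j x => law_nonneg hP _ _)
    (fun i j x => law_nonneg hP _ _) (fun i => ?_) (fun i => ?_)
    ⟨fun x => law_nonneg hP _ _, by rw [sum_law, h1]⟩ ?_
  · ext c
    rw [Finset.sum_apply, ← sum_law_pair_right P (fun ω => (a₀ ω, x ω)) a₁]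
    exact Finset.sum_congr rfl fun j _ => law_eq_of_iff P (by simp; tauto)
  · ext c
    rw [Finset.sum_apply, ← sum_law_pair_right P (fun ω => (a₀ ω, x ω)) a₂]
    exact Finset.sum_congr rfl fun j _ => law_eq_of_iff P (by simp; tauto)
  · ext c
    rw [Finset.sum_apply, sum_law_pair_left]

end Bounds

/-! ### The channels to the individual receivers. -/

section Marginals

variable {X Y₁ Y₂ : Type*} [Fintype Y₁] [Fintype Y₂]

/-- The transition probabilities to the first receiver of a broadcast channel. -/
def margOne (W : CondDist X (Y₁ × Y₂)) (x : X) : Y₁ → ℝ := law (W x) Prod.fst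

/-- The transition probabilities to the second receiver of a broadcast channel. -/
def margTwo (W : CondDist X (Y₁ × Y₂)) (x : X) : Y₂ → ℝ := law (W x) Prod.snd

theorem sum_margOne (W : CondDist X (Y₁ × Y₂)) (x : X) : ∑ y, margOne W x y = 1 := by
  rw [margOne, sum_law, stdSimplex.sum_eq_one]

theorem sum_margTwo (W : CondDist X (Y₁ × Y₂)) (x : X) : ∑ y, margTwo W x y = 1 := by
  rw [margTwo, sum_law, stdSimplex.sum_eq_one]

theorem margOne_nonneg (W : CondDist X (Y₁ × Y₂)) (x : X) (y : Y₁) : 0 ≤ margOne W x y :=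
  law_nonneg (fun _ => stdSimplex.zero_le _ _) _ _

theorem margTwo_nonneg (W : CondDist X (Y₁ × Y₂)) (x : X) (y : Y₂) : 0 ≤ margTwo W x y :=
  law_nonneg (fun _ => stdSimplex.zero_le _ _) _ _

end Marginals

/-! ### Correspondence between test channels and hull points. -/

section TestChannel

variable {X Y₁ Y₂ V₀ V₁ V₂ : Type*} [Fintype X] [Fintype Y₁] [Fintype Y₂]
  [Fintype V₀] [Fintype V₁] [Fintype V₂]

/-- The right-hand sides of the outer-bound inequalities for a test distribution. -/
def testBounds (q : CondDist X (V₀ × V₁ × V₂)) (pX : ProbDist X) (W : CondDist X (Y₁ × Y₂)) :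
    Fin 5 → ℝ :=
  infoBounds (testLaw q pX W) (fun ω => ω.1.1) (fun ω => ω.1.2.1) (fun ω => ω.1.2.2)
    (fun ω => ω.2.1) (fun ω => ω.2.2.1) (fun ω => ω.2.2.2)

theorem outerConstraints_iff (q : CondDist X (V₀ × V₁ × V₂)) (pX : ProbDist X)
    (W : CondDist X (Y₁ × Y₂)) (R₀ R₁ R₂ : ℝ) :
    OuterConstraints q pX W R₀ R₁ R₂ ↔ 0 ≤ R₀ ∧ 0 ≤ R₁ ∧ 0 ≤ R₂ ∧
      ∀ t, ![R₀, R₀ + R₁, R₀ + R₂, R₀ + R₁ + R₂, R₀ + R₁ + R₂] t ≤ testBounds q pX W t := by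
  rw [OuterConstraints, Fin.forall_fin_succ, Fin.forall_fin_succ, Fin.forall_fin_succ,
    Fin.forall_fin_succ, Fin.forall_fin_one]
  rfl

theorem testLaw_nonneg (q : CondDist X (V₀ × V₁ × V₂)) (pX : ProbDist X)
    (W : CondDist X (Y₁ × Y₂)) (ω) : 0 ≤ testLaw q pX W ω :=
  mul_nonneg (mul_nonneg (stdSimplex.zero_le _ _) (stdSimplex.zero_le _ _))
    (stdSimplex.zero_le _ _)

theorem sum_testLaw (q : CondDist X (V₀ × V₁ × V₂)) (pX : ProbDist X)
    (W : CondDist X (Y₁ × Y₂)) : ∑ ω, testLaw q pX W ω = 1 := by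
  rw [Fintype.sum_prod_type, Finset.sum_comm, Fintype.sum_prod_type]
  simp only [testLaw, ← Finset.mul_sum, ← Finset.sum_mul, stdSimplex.sum_eq_one, mul_one, one_mul]

theorem law_testLaw_fst (q : CondDist X (V₀ × V₁ × V₂)) (pX : ProbDist X)
    (W : CondDist X (Y₁ × Y₂)) (v : V₀ × V₁ × V₂) (x : X) :
    law (testLaw q pX W) (fun ω => (ω.1, ω.2.1)) (v, x) = q x v * pX x := by
  classical
  rw [law_eq_sum_ite, Fintype.sum_prod_type, Finset.sum_eq_single v, Fintype.sum_prod_type,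
    Finset.sum_eq_single x]
  · simp only [if_true, testLaw, ← Finset.mul_sum, stdSimplex.sum_eq_one, mul_one]
  · intro b _ hb; simp [hb]
  · simp
  · intro b _ hb; simp [hb]
  · simp

theorem isChannelOutput_testLaw (q : CondDist X (V₀ × V₁ × V₂)) (pX : ProbDist X)
    (W : CondDist X (Y₁ × Y₂)) :
    IsChannelOutput (testLaw q pX W) (fun ω => ω.1) (fun ω => ω.2.1) (fun ω => ω.2.2)
      fun x => W x := by
  classical
  intro v x y
  rw [law_testLaw_fst, law_eq_sum_ite]
  rw [Finset.sum_eq_single (v, x, y)]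
  · rw [if_pos rfl, testLaw]
  · intro ω _ hω
    exact if_neg hω
  · simp

theorem law_testLaw_input (q : CondDist X (V₀ × V₁ × V₂)) (pX : ProbDist X)
    (W : CondDist X (Y₁ × Y₂)) (x : X) :
    law (testLaw q pX W) (fun ω => ω.2.1) x = pX x := by
  rw [← sum_law_pair_left _ (fun ω : (V₀ × V₁ × V₂) × X × (Y₁ × Y₂) => ω.1)]
  simp only [law_testLaw_fst, ← Finset.sum_mul, stdSimplex.sum_eq_one, one_mul]

theorem testBounds_eq_hullBounds (q : CondDist X (V₀ × V₁ × V₂)) (pX : ProbDist X)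
    (W : CondDist X (Y₁ × Y₂)) :
    testBounds q pX W = hullBounds (margOne W) (margTwo W)
      (auxPoint (testLaw q pX W) (fun ω => ω.1.1) (fun ω => ω.1.2.1) (fun ω => ω.1.2.2)
        (fun ω => ω.2.1) (fun ω => ω.2.2.1) (fun ω => ω.2.2.2)) := by
  have h := isChannelOutput_testLaw q pX W
  have h₁ : IsChannelOutput (testLaw q pX W) (fun ω => ω.1.1) (fun ω => ω.2.1)
    (fun ω => ω.2.2.1) (margOne W) := h.comp (fun v => v.1) Prod.fst
  have h₂ : IsChannelOutput (testLaw q pX W) (fun ω => ω.1.1) (fun ω => ω.2.1)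
    (fun ω => ω.2.2.2) (margTwo W) := h.comp (fun v => v.1) Prod.snd
  have h₃ : IsChannelOutput (testLaw q pX W) (fun ω => (ω.1.1, ω.1.2.1)) (fun ω => ω.2.1)
    (fun ω => ω.2.2.2) (margTwo W) := h.comp (fun v => (v.1, v.2.1)) Prod.snd
  have h₄ : IsChannelOutput (testLaw q pX W) (fun ω => (ω.1.1, ω.1.2.2)) (fun ω => ω.2.1)
    (fun ω => ω.2.2.1) (margOne W) := h.comp (fun v => (v.1, v.2.2)) Prod.fst
  rw [testBounds, infoBounds_eq (testLaw_nonneg q pX W) (sum_testLaw q pX W), h₁.condEnt_unit_eq,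
    h₂.condEnt_unit_eq, h₃.condEnt_eq_noiseEnt (sum_margTwo W),
    h₄.condEnt_eq_noiseEnt (sum_margOne W)]
  rfl

/-- A hull point prescribes the joint laws of `(V₀, V₁, X)` and `(V₀, V₂, X)` but not that of all
four variables. Gluing `V₁` and `V₂` conditionally independently given `(V₀, X)`, with joint mass
`r₁ r₂ / u`, realises both. -/
theorem exists_testBounds_eq (W : CondDist X (Y₁ × Y₂)) (pX : ProbDist X)
    {z : (X → ℝ) × (ℝ × ℝ) × (ℝ × ℝ) × (ℝ × ℝ)} (hz : z ∈ auxHull (margOne W) (margTwo W))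
    (hzX : z.1 = pX) :
    ∃ (k₀ k₁ k₂ : ℕ) (q : CondDist X (Fin k₀ × Fin k₁ × Fin k₂)),
      testBounds q pX W = hullBounds (margOne W) (margTwo W) z := by
  obtain ⟨m, n, r₁, r₂, u, hr₁, hr₂, hu₁, hu₂, rfl⟩ :=
    exists_of_mem_auxHull (sum_margOne W) (sum_margTwo W) hz
  have hu : ∀ i x, 0 ≤ u i x := fun i x => by
    rw [← hu₁, Finset.sum_apply]
    exact Finset.sum_nonneg fun j _ => hr₁ i j x
  have s₁ : ∀ i x, ∑ j, r₁ i j x = u i x := fun i x => by rw [← hu₁, Finset.sum_apply]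
  have s₂ : ∀ i x, ∑ j, r₂ i j x = u i x := fun i x => by rw [← hu₂, Finset.sum_apply]
  have s₀ : ∀ x, ∑ i, u i x = pX x := fun x => by
    rw [← Finset.sum_apply]
    exact congrFun hzX x
  have le₁ : ∀ i j x, r₁ i j x ≤ u i x := fun i j x => by
    rw [← s₁]
    exact Finset.single_le_sum (f := fun j => r₁ i j x) (fun j _ => hr₁ i j x) (Finset.mem_univ j)
  have le₂ : ∀ i j x, r₂ i j x ≤ u i x := fun i j x => by
    rw [← s₂]
    exact Finset.single_le_sum (f := fun j => r₂ i j x) (fun j _ => hr₂ i j x) (Finset.mem_univ j)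
  have le₀ : ∀ i x, u i x ≤ pX x := fun i x => by
    rw [← s₀]
    exact Finset.single_le_sum (f := fun i => u i x) (fun j _ => hu j x) (Finset.mem_univ i)
  have t₁ : ∀ i j x, ∑ l, r₁ i j x * r₂ i l x / u i x = r₁ i j x := fun i j x => by
    rw [← Finset.sum_div, ← Finset.mul_sum, s₂]
    rcases (hu i x).eq_or_lt with h0 | h0
    · rw [← h0, div_zero]
      exact le_antisymm (hr₁ i j x) (h0 ▸ le₁ i j x)
    · exact mul_div_cancel_right₀ _ h0.ne'
  have t₂ : ∀ i l x, ∑ j, r₁ i j x * r₂ i l x / u i x = r₂ i l x := fun i l x => by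
    rw [← Finset.sum_div, ← Finset.sum_mul, s₁]
    rcases (hu i x).eq_or_lt with h0 | h0
    · rw [← h0, div_zero]
      exact le_antisymm (hr₂ i l x) (h0 ▸ le₂ i l x)
    · exact mul_div_cancel_left₀ _ h0.ne'
  have hq : ∀ x, ∃ d : ProbDist (Fin (m + 1) × Fin (n + 1) × Fin (n + 1)), ∀ v,
      d v * pX x = r₁ v.1 v.2.1 x * r₂ v.1 v.2.2 x / u v.1 x := by
    intro x
    rcases (stdSimplex.zero_le pX x).eq_or_lt with h0 | h0
    -- At an input letter of probability zero the conditional law is arbitrary.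
    · refine ⟨⟨Pi.single (0, 0, 0) 1, single_mem_stdSimplex ℝ _⟩, fun v => ?_⟩
      have : u v.1 x = 0 := le_antisymm (h0 ▸ le₀ v.1 x) (hu _ _)
      rw [← h0, this, mul_zero, div_zero]
    · refine ⟨⟨fun v => r₁ v.1 v.2.1 x * r₂ v.1 v.2.2 x / u v.1 x / pX x, fun v => ?_, ?_⟩,
        fun v => div_mul_cancel₀ _ h0.ne'⟩
      · have := hr₁ v.1 v.2.1 x
        have := hr₂ v.1 v.2.2 x
        have := hu v.1 x
        positivity
      · simp only [Fintype.sum_prod_type]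
        simp only [← Finset.sum_div _ _ (pX x), t₁, s₁, s₀]
        exact div_self h0.ne'
  choose q hq using hq
  refine ⟨_, _, _, q, ?_⟩
  rw [testBounds_eq_hullBounds]
  congr 1
  have h := isChannelOutput_testLaw q pX W
  have lawV := law_testLaw_fst q pX W
  have l₁ : ∀ i j x, law (testLaw q pX W) (fun ω => ((ω.1.1, ω.1.2.1), ω.2.1)) ((i, j), x) =
      r₁ i j x := fun i j x => by
    rw [← t₁, ← sum_law_pair_right _ _ (fun ω => ω.1.2.2)]
    refine Finset.sum_congr rfl fun l _ => ?_
    rw [← hq x (i, j, l), ← lawV]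
    exact law_eq_of_iff _ (by simp [Prod.ext_iff]; tauto)
  have l₂ : ∀ i j x, law (testLaw q pX W) (fun ω => ((ω.1.1, ω.1.2.2), ω.2.1)) ((i, j), x) =
      r₂ i j x := fun i j x => by
    rw [← t₂, ← sum_law_pair_right _ _ (fun ω => ω.1.2.1)]
    refine Finset.sum_congr rfl fun l _ => ?_
    rw [← hq x (i, l, j), ← lawV]
    exact law_eq_of_iff _ (by simp [Prod.ext_iff]; tauto)
  have l₀ : ∀ i x, law (testLaw q pX W) (fun ω => (ω.1.1, ω.2.1)) (i, x) = u i x := fun i x => by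
    rw [← s₁, ← sum_law_pair_right _ _ (fun ω => ω.1.2.1)]
    refine Finset.sum_congr rfl fun l _ => ?_
    rw [← l₁]
    exact law_eq_of_iff _ (by simp; tauto)
  have e₁ := (h.comp (fun v => v.1) Prod.fst).condEnt_eq
  have e₂ := (h.comp (fun v => v.1) Prod.snd).condEnt_eq
  have e₃ := (h.comp (fun v => (v.1, v.2.1)) Prod.fst).condEnt_eq
  have e₄ := (h.comp (fun v => (v.1, v.2.1)) Prod.snd).condEnt_eq
  have e₅ := (h.comp (fun v => (v.1, v.2.2)) Prod.fst).condEnt_eq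
  have e₆ := (h.comp (fun v => (v.1, v.2.2)) Prod.snd).condEnt_eq
  simp only [Fintype.sum_prod_type, l₀, l₁, l₂] at e₁ e₂ e₃ e₄ e₅ e₆
  simp only [auxPoint, e₁, e₂, e₃, e₄, e₅, e₆]
  have e₀ : law (testLaw q pX W) (fun ω => ω.2.1) = ∑ i, u i := by
    ext x
    rw [law_testLaw_input, Finset.sum_apply, s₀]
  rw [e₀]
  rfl

end TestChannel

/-! ### Single-letterization over a memoryless broadcast channel. -/

section ChannelBlock

variable {Θ υ X Y Y₁ Y₂ M₀ M₁ M₂ N : Type*} [Fintype Θ] [Fintype υ] [Fintype X] [Fintype Y]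
  [Fintype Y₁] [Fintype Y₂] [Fintype M₀] [Fintype M₁] [Fintype M₂] [Fintype N] {n : ℕ}

/-- The joint law of a random seed `θ` and of the output block of a memoryless channel whose input
block is a function of `θ`. -/
def chanLaw (p : Θ → ℝ) (x : Θ → Fin n → X) (W : CondDist X Y) (ω : Θ × (Fin n → Y)) : ℝ :=
  p ω.1 * ∏ q, W (x ω.1 q) (ω.2 q)

theorem chanLaw_nonneg {p : Θ → ℝ} (hp : ∀ θ, 0 ≤ p θ) (x : Θ → Fin n → X) (W : CondDist X Y)
    (ω) : 0 ≤ chanLaw p x W ω :=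
  mul_nonneg (hp _) (Finset.prod_nonneg fun _ _ => stdSimplex.zero_le _ _)

theorem sum_chanLaw_right (p : Θ → ℝ) (x : Θ → Fin n → X) (W : CondDist X Y) (θ : Θ) :
    ∑ y, chanLaw p x W (θ, y) = p θ := by
  classical
  simp only [chanLaw, ← Finset.mul_sum]
  rw [← Fintype.piFinset_univ, ← Finset.prod_univ_sum]
  simp

theorem law_chanLaw_comp_fst (p : Θ → ℝ) (x : Θ → Fin n → X) (W : CondDist X Y) (f : Θ → υ)
    (u : υ) : law (chanLaw p x W) (fun ω => f ω.1) u = law p f u := by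
  classical
  rw [law_eq_sum_ite, law_eq_sum_ite, Fintype.sum_prod_type]
  refine Finset.sum_congr rfl fun θ _ => ?_
  by_cases h : f θ = u
  · simp [h, sum_chanLaw_right]
  · simp [h]

theorem sum_chanLaw (p : Θ → ℝ) (x : Θ → Fin n → X) (W : CondDist X Y) :
    ∑ ω, chanLaw p x W ω = ∑ θ, p θ := by
  rw [Fintype.sum_prod_type]
  simp only [sum_chanLaw_right]

/-- The input block is fixed by the seed (no feedback), so changing the `q`-th output letter alters
only one factor of the mass and leaves `U` unchanged. The resulting exchange identity, summed over
the replacement letter, is the claim. -/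
theorem isChannelOutput_chanLaw (p : Θ → ℝ) (x : Θ → Fin n → X) (W : CondDist X Y) (q : Fin n)
    {U : Θ × (Fin n → Y) → υ}
    (hU : ∀ θ y y', (∀ j, j ≠ q → y j = y' j) → U (θ, y) = U (θ, y')) :
    IsChannelOutput (chanLaw p x W) U (fun ω => x ω.1 q) (fun ω => ω.2 q) fun x => W x := by
  classical
  have swap : ∀ u a b b', law (chanLaw p x W) (fun ω => (U ω, x ω.1 q, ω.2 q)) (u, a, b) * W a b' =
      law (chanLaw p x W) (fun ω => (U ω, x ω.1 q, ω.2 q)) (u, a, b') * W a b := by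
    intro u a b b'
    rw [law, law, Finset.sum_mul, Finset.sum_mul]
    refine Finset.sum_nbij' (fun ω => (ω.1, Function.update ω.2 q b'))
      (fun ω => (ω.1, Function.update ω.2 q b)) ?_ ?_ ?_ ?_ ?_
    · rintro ⟨θ, y⟩ h
      simp only [Finset.mem_filter, Finset.mem_univ, true_and, Prod.mk.injEq] at h ⊢
      refine ⟨?_, h.2.1, by simp⟩
      rw [← h.1]
      exact hU _ _ _ fun j hj => by simp [hj]
    · rintro ⟨θ, y⟩ h
      simp only [Finset.mem_filter, Finset.mem_univ, true_and, Prod.mk.injEq] at h ⊢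
      refine ⟨?_, h.2.1, by simp⟩
      rw [← h.1]
      exact hU _ _ _ fun j hj => by simp [hj]
    · rintro ⟨θ, y⟩ h
      simp only [Finset.mem_filter, Finset.mem_univ, true_and, Prod.mk.injEq] at h
      simp [← h.2.2]
    · rintro ⟨θ, y⟩ h
      simp only [Finset.mem_filter, Finset.mem_univ, true_and, Prod.mk.injEq] at h
      simp [← h.2.2]
    · rintro ⟨θ, y⟩ h
      simp only [Finset.mem_filter, Finset.mem_univ, true_and, Prod.mk.injEq] at h
      have e : ∏ j ∈ Finset.univ.erase q, W (x θ j) (Function.update y q b' j) =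
          ∏ j ∈ Finset.univ.erase q, W (x θ j) (y j) :=
        Finset.prod_congr rfl fun j hj => by
          rw [Function.update_of_ne (Finset.ne_of_mem_erase hj)]
      simp only [chanLaw]
      rw [← Finset.mul_prod_erase _ _ (Finset.mem_univ q),
        ← Finset.mul_prod_erase _ (fun j => W (x θ j) (Function.update y q b' j))
        (Finset.mem_univ q), e, Function.update_self, h.2.1, h.2.2]
      ring
  intro u a b
  have h := Finset.sum_congr (rfl : (Finset.univ : Finset Y) = Finset.univ)
    fun b' _ => swap u a b b'
  rw [← Finset.mul_sum, ← Finset.sum_mul, stdSimplex.sum_eq_one, mul_one] at h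
  rw [h, ← sum_law_pair_right _ (fun ω => (U ω, x ω.1 q)) fun ω : Θ × (Fin n → Y) => ω.2 q]
  congr 1
  exact Finset.sum_congr rfl fun b' _ => law_eq_of_iff _ (by simp; tauto)

/-- Arithmetic of the converse: `H`, `g` and the primed letters are block entropies, while `S`, `h`
and the unprimed `a`, `b` are sums over time. The Csiszár identities equate differences between the
receivers. Hence enlarging the common auxiliary lowers both `g₁` and `g₂` by the same amount, and
what the private terms lose is gained by the common minimum. -/
theorem outerBounds_le_of_csiszar {H₁ H₂ S₁ S₂ g₁ g₂ h₁ h₂ a₁ b₁ a₁' b₁' a₂ b₂ a₂' b₂' e₁ e₂ : ℝ}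
    (hS₁ : H₁ ≤ S₁) (hS₂ : H₂ ≤ S₂) (hh : h₁ - h₂ = g₁ - g₂) (hh₁ : h₁ ≤ g₁)
    (ha : a₁ - b₁ = a₁' - b₁') (ha₁ : a₁ ≤ a₁') (hb : a₂ - b₂ = a₂' - b₂') (hb₂ : a₂ ≤ a₂')
    (t : Fin 5) :
    outerBounds (H₁ - g₁) (H₂ - g₂) (g₁ - a₁') (g₂ - b₂') (b₁' - e₂) (a₂' - e₁) t ≤
      outerBounds (S₁ - h₁) (S₂ - h₂) (h₁ - a₁) (h₂ - b₂) (b₁ - e₂) (a₂ - e₁) t := by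
  -- Both arguments of the minimum grow by at least `g₁ - h₁ = g₂ - h₂`.
  have hmin : min (H₁ - g₁) (H₂ - g₂) + (g₁ - h₁) ≤ min (S₁ - h₁) (S₂ - h₂) := by
    refine le_min ?_ ?_
    · linarith [min_le_left (H₁ - g₁) (H₂ - g₂)]
    · linarith [min_le_right (H₁ - g₁) (H₂ - g₂)]
  have key : ∀ m m' : ℝ, m + (g₁ - h₁) ≤ m' → ∀ t : Fin 5,
      (![m, m + (g₁ - a₁'), m + (g₂ - b₂'), m + (g₁ - a₁') + (b₁' - e₂),
        m + (g₂ - b₂') + (a₂' - e₁)] : Fin 5 → ℝ) t ≤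
      (![m', m' + (h₁ - a₁), m' + (h₂ - b₂), m' + (h₁ - a₁) + (b₁ - e₂),
        m' + (h₂ - b₂) + (a₂ - e₁)] : Fin 5 → ℝ) t := by
    intro m m' hm t
    fin_cases t <;> simp <;> linarith
  exact key _ _ hmin t

/-- Coordinate `q` of the first receiver's output block. -/
def outOne (q : Fin n) (ω : Θ × (Fin n → Y₁ × Y₂)) : Y₁ := (ω.2 q).1

/-- Coordinate `q` of the second receiver's output block. -/
def outTwo (q : Fin n) (ω : Θ × (Fin n → Y₁ × Y₂)) : Y₂ := (ω.2 q).2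

/-- The common auxiliary variable at time `q`: the common message, the past outputs of the first
receiver and the future outputs of the second receiver. -/
def commonAux (m₀ : Θ → M₀) (q : Fin n) (ω : Θ × (Fin n → Y₁ × Y₂)) :
    M₀ × ({j : Fin n // (j : ℕ) < q} → Y₁) × ({j : Fin n // (q : ℕ) + 1 ≤ j} → Y₂) :=
  (m₀ ω.1, prefixVar q outOne ω, suffixVar (q + 1) outTwo ω)

/-- The single-letter point at time `q`. -/
def letterPoint (p : Θ → ℝ) (x : Θ → Fin n → X) (W : CondDist X (Y₁ × Y₂)) (m₀ : Θ → M₀)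
    (m₁ : Θ → M₁) (m₂ : Θ → M₂) (q : Fin n) : (X → ℝ) × (ℝ × ℝ) × (ℝ × ℝ) × (ℝ × ℝ) :=
  auxPoint (chanLaw p x W) (commonAux m₀ q) (fun ω => m₁ ω.1) (fun ω => m₂ ω.1)
    (fun ω => x ω.1 q) (outOne q) (outTwo q)

theorem prefixVar_outOne_congr (q : Fin n) {θ : Θ} {y y' : Fin n → Y₁ × Y₂}
    (h : ∀ j, j ≠ q → y j = y' j) :
    prefixVar q (outOne (Θ := Θ) (Y₁ := Y₁) (Y₂ := Y₂)) (θ, y) = prefixVar q outOne (θ, y') := by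
  rw [prefixVar_eq_iff]
  intro j hj
  exact congrArg Prod.fst (h j (by rintro rfl; exact lt_irrefl _ hj))

theorem prefixVar_outTwo_congr (q : Fin n) {θ : Θ} {y y' : Fin n → Y₁ × Y₂}
    (h : ∀ j, j ≠ q → y j = y' j) :
    prefixVar q (outTwo (Θ := Θ) (Y₁ := Y₁) (Y₂ := Y₂)) (θ, y) = prefixVar q outTwo (θ, y') := by
  rw [prefixVar_eq_iff]
  intro j hj
  exact congrArg Prod.snd (h j (by rintro rfl; exact lt_irrefl _ hj))

theorem suffixVar_outTwo_congr (q : Fin n) {θ : Θ} {y y' : Fin n → Y₁ × Y₂}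
    (h : ∀ j, j ≠ q → y j = y' j) :
    suffixVar (q + 1) (outTwo (Θ := Θ) (Y₁ := Y₁) (Y₂ := Y₂)) (θ, y) =
      suffixVar (q + 1) outTwo (θ, y') := by
  rw [suffixVar_eq_iff]
  intro j hj
  exact congrArg Prod.snd (h j (by rintro rfl; omega))

theorem commonAux_congr (m₀ : Θ → M₀) (q : Fin n) {θ : Θ} {y y' : Fin n → Y₁ × Y₂}
    (h : ∀ j, j ≠ q → y j = y' j) : commonAux m₀ q (θ, y) = commonAux m₀ q (θ, y') := by
  rw [commonAux, commonAux, prefixVar_outOne_congr q h, suffixVar_outTwo_congr q h]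

theorem isChannelOutput_outOne (p : Θ → ℝ) (x : Θ → Fin n → X) (W : CondDist X (Y₁ × Y₂))
    (q : Fin n) {U : Θ × (Fin n → Y₁ × Y₂) → υ}
    (hU : ∀ θ y y', (∀ j, j ≠ q → y j = y' j) → U (θ, y) = U (θ, y')) :
    IsChannelOutput (chanLaw p x W) U (fun ω => x ω.1 q) (outOne q) (margOne W) :=
  (isChannelOutput_chanLaw p x W q hU).comp id Prod.fst

theorem isChannelOutput_outTwo (p : Θ → ℝ) (x : Θ → Fin n → X) (W : CondDist X (Y₁ × Y₂))
    (q : Fin n) {U : Θ × (Fin n → Y₁ × Y₂) → υ}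
    (hU : ∀ θ y y', (∀ j, j ≠ q → y j = y' j) → U (θ, y) = U (θ, y')) :
    IsChannelOutput (chanLaw p x W) U (fun ω => x ω.1 q) (outTwo q) (margTwo W) :=
  (isChannelOutput_chanLaw p x W q hU).comp id Prod.snd

theorem letterPoint_mem_auxHull {p : Θ → ℝ} (hp : ∀ θ, 0 ≤ p θ) (hp1 : ∑ θ, p θ = 1)
    (x : Θ → Fin n → X) (W : CondDist X (Y₁ × Y₂)) (m₀ : Θ → M₀)
    (m₁ : Θ → M₁) (m₂ : Θ → M₂) (q : Fin n) :
    letterPoint p x W m₀ m₁ m₂ q ∈ auxHull (margOne W) (margTwo W) := by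
  refine auxPoint_mem_auxHull (chanLaw_nonneg hp x W) (by rw [sum_chanLaw, hp1]) (sum_margOne W)
    (sum_margTwo W) ?_ ?_ ?_ ?_ ?_ ?_
  · exact isChannelOutput_outOne p x W q fun θ y y' h => commonAux_congr m₀ q h
  · exact isChannelOutput_outTwo p x W q fun θ y y' h => commonAux_congr m₀ q h
  · exact isChannelOutput_outOne p x W q fun θ y y' h => by simp [commonAux_congr m₀ q h]
  · exact isChannelOutput_outTwo p x W q fun θ y y' h => by simp [commonAux_congr m₀ q h]
  · exact isChannelOutput_outOne p x W q fun θ y y' h => by simp [commonAux_congr m₀ q h]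
  · exact isChannelOutput_outTwo p x W q fun θ y y' h => by simp [commonAux_congr m₀ q h]

/-- Single-letterization of the outer bound for a memoryless broadcast channel. -/
theorem infoBounds_chanLaw_le {p : Θ → ℝ} (hp : ∀ θ, 0 ≤ p θ) (hp1 : ∑ θ, p θ = 1)
    (x : Θ → Fin n → X) (W : CondDist X (Y₁ × Y₂)) (m₀ : Θ → M₀)
    (m₁ : Θ → M₁) (m₂ : Θ → M₂) (s : Θ → N) (hs : ∀ θ θ', s θ = s θ' → x θ = x θ') (t : Fin 5) :
    infoBounds (chanLaw p x W) (fun ω => m₀ ω.1) (fun ω => m₁ ω.1) (fun ω => m₂ ω.1)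
      (fun ω => s ω.1) (fun ω q => outOne q ω) (fun ω q => outTwo q ω) t ≤
    outerBounds
      (∑ q, outEnt (margOne W) (letterPoint p x W m₀ m₁ m₂ q).1 -
        ∑ q, (letterPoint p x W m₀ m₁ m₂ q).2.1.1)
      (∑ q, outEnt (margTwo W) (letterPoint p x W m₀ m₁ m₂ q).1 -
        ∑ q, (letterPoint p x W m₀ m₁ m₂ q).2.1.2)
      (∑ q, (letterPoint p x W m₀ m₁ m₂ q).2.1.1 - ∑ q, (letterPoint p x W m₀ m₁ m₂ q).2.2.1.1)
      (∑ q, (letterPoint p x W m₀ m₁ m₂ q).2.1.2 - ∑ q, (letterPoint p x W m₀ m₁ m₂ q).2.2.2.2)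
      (∑ q, (letterPoint p x W m₀ m₁ m₂ q).2.2.1.2 -
        ∑ q, noiseEnt (margTwo W) (letterPoint p x W m₀ m₁ m₂ q).1)
      (∑ q, (letterPoint p x W m₀ m₁ m₂ q).2.2.2.1 -
        ∑ q, noiseEnt (margOne W) (letterPoint p x W m₀ m₁ m₂ q).1) t := by
  have hP := chanLaw_nonneg hp x W
  have hP1 : ∑ ω, chanLaw p x W ω = 1 := by rw [sum_chanLaw, hp1]
  rw [infoBounds_eq hP hP1]
  set P := chanLaw p x W with hPdef
  -- `s` determines the whole input block, so every term of the chain rule is pure channel noise.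
  have noise₂ : condEnt P (fun ω q => outTwo q ω) (fun ω => (s ω.1, m₀ ω.1, m₁ ω.1)) =
      ∑ q, noiseEnt (margTwo W) (law P fun ω => x ω.1 q) := by
    rw [← sum_condEnt_prefixVar]
    refine Finset.sum_congr rfl fun q _ => ?_
    refine (isChannelOutput_outTwo p x W q fun θ y y' h => ?_).condEnt_eq_noiseEnt_of_determines
      (sum_margTwo W) fun ω ω' h => ?_
    · rw [prefixVar_outTwo_congr q h]
    · simp only [Prod.mk.injEq] at h
      rw [hs _ _ h.2.1]
  have noise₁ : condEnt P (fun ω q => outOne q ω) (fun ω => (s ω.1, m₀ ω.1, m₂ ω.1)) =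
      ∑ q, noiseEnt (margOne W) (law P fun ω => x ω.1 q) := by
    rw [← sum_condEnt_prefixVar]
    refine Finset.sum_congr rfl fun q _ => ?_
    refine (isChannelOutput_outOne p x W q fun θ y y' h => ?_).condEnt_eq_noiseEnt_of_determines
      (sum_margOne W) fun ω ω' h => ?_
    · rw [prefixVar_outOne_congr q h]
    · simp only [Prod.mk.injEq] at h
      rw [hs _ _ h.2.1]
  have marg₁ : condEnt P (fun ω q => outOne q ω) (fun _ => ()) ≤
      ∑ q, outEnt (margOne W) (law P fun ω => x ω.1 q) := by
    rw [← sum_condEnt_prefixVar]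
    refine Finset.sum_le_sum fun q _ => ?_
    rw [← (isChannelOutput_outOne p x W q (U := fun _ => ()) fun _ _ _ _ => rfl).condEnt_unit_eq]
    exact condEnt_le_of_determines hP _ fun _ _ _ => rfl
  have marg₂ : condEnt P (fun ω q => outTwo q ω) (fun _ => ()) ≤
      ∑ q, outEnt (margTwo W) (law P fun ω => x ω.1 q) := by
    rw [← sum_condEnt_prefixVar]
    refine Finset.sum_le_sum fun q _ => ?_
    rw [← (isChannelOutput_outTwo p x W q (U := fun _ => ()) fun _ _ _ _ => rfl).condEnt_unit_eq]
    exact condEnt_le_of_determines hP _ fun _ _ _ => rfl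
  simp only [letterPoint, auxPoint, ← hPdef]
  rw [noise₁, noise₂]
  refine outerBounds_le_of_csiszar marg₁ marg₂ ?_ ?_ ?_ ?_ ?_ ?_ t
  -- The identity is used given `m₀`, `(m₀, m₁)` and `(m₀, m₂)`. It alternates with inequalities
  -- saying that `commonAux` conditions on more than the prefix in the chain rule for receiver 1.
  · exact sum_condEnt_prefixVar_suffixVar P outOne outTwo fun ω => m₀ ω.1
  · rw [← sum_condEnt_prefixVar]
    refine Finset.sum_le_sum fun q _ => condEnt_le_of_determines hP _ fun ω ω' h => ?_
    simp only [commonAux, Prod.mk.injEq] at h ⊢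
    tauto
  · rw [← sum_condEnt_prefixVar_suffixVar P outOne outTwo fun ω => (m₀ ω.1, m₁ ω.1)]
    congr 1
    all_goals
      refine Finset.sum_congr rfl fun q _ => condEnt_congr P (fun ω ω' => ?_) fun ω ω' => ?_
      all_goals
        simp only [commonAux, Prod.mk.injEq]
        tauto
  · rw [← sum_condEnt_prefixVar]
    refine Finset.sum_le_sum fun q _ => condEnt_le_of_determines hP _ fun ω ω' h => ?_
    simp only [commonAux, Prod.mk.injEq] at h ⊢
    tauto
  · rw [← sum_condEnt_prefixVar_suffixVar P outOne outTwo fun ω => (m₀ ω.1, m₂ ω.1)]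
    congr 1
    all_goals
      refine Finset.sum_congr rfl fun q _ => condEnt_congr P (fun ω ω' => ?_) fun ω ω' => ?_
      all_goals
        simp only [commonAux, Prod.mk.injEq]
        tauto
  · rw [← sum_condEnt_prefixVar]
    refine Finset.sum_le_sum fun q _ => condEnt_le_of_determines hP _ fun ω ω' h => ?_
    simp only [commonAux, Prod.mk.injEq] at h ⊢
    tauto

/-- The average input distribution of an encoder block. -/
def meanInput (p : Θ → ℝ) (x : Θ → Fin n → X) : X → ℝ :=
  ∑ q, (n : ℝ)⁻¹ • law p fun θ => x θ q

theorem meanInput_mem_stdSimplex {p : Θ → ℝ} (hp : ∀ θ, 0 ≤ p θ) (hp1 : ∑ θ, p θ = 1)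
    (x : Θ → Fin n → X) (hn : 0 < n) : meanInput p x ∈ stdSimplex ℝ X := by
  have hn' : (0 : ℝ) < n := Nat.cast_pos.2 hn
  refine (convex_stdSimplex ℝ X).sum_mem (fun _ _ => by positivity) ?_ fun q _ =>
    ⟨fun a => law_nonneg hp _ _, by rw [sum_law, hp1]⟩
  simp [hn'.ne']

/-- Noise entropy is linear in the input law, so it survives averaging exactly; it enters the bounds
with a minus sign. -/
theorem sum_noiseEnt (k : X → Y → ℝ) (hn : 0 < n) (p : Fin n → X → ℝ) :
    ∑ q, noiseEnt k (p q) = n * noiseEnt k (∑ q, (n : ℝ)⁻¹ • p q) := by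
  have hn' : (n : ℝ) ≠ 0 := Nat.cast_ne_zero.2 hn.ne'
  simp only [noiseEnt, Finset.sum_apply, Pi.smul_apply, smul_eq_mul, ← Finset.mul_sum]
  rw [Finset.sum_comm]
  simp only [mul_assoc, ← Finset.mul_sum]
  rw [mul_inv_cancel_left₀ hn']
  simp only [Finset.sum_mul]

/-- Convexity of the hull replaces a time-sharing variable: take the average of the letter points.
Every term is linear in the point except the output entropy, which is concave and enters with a plus
sign. -/
theorem exists_infoBounds_chanLaw_le {p : Θ → ℝ} (hp : ∀ θ, 0 ≤ p θ) (hp1 : ∑ θ, p θ = 1)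
    (x : Θ → Fin n → X) (hn : 0 < n) (W : CondDist X (Y₁ × Y₂)) (m₀ : Θ → M₀)
    (m₁ : Θ → M₁) (m₂ : Θ → M₂) (s : Θ → N) (hs : ∀ θ θ', s θ = s θ' → x θ = x θ') :
    ∃ z ∈ auxHull (margOne W) (margTwo W), z.1 = meanInput p x ∧ ∀ t,
    infoBounds (chanLaw p x W) (fun ω => m₀ ω.1) (fun ω => m₁ ω.1) (fun ω => m₂ ω.1)
      (fun ω => s ω.1) (fun ω q => outOne q ω) (fun ω q => outTwo q ω) t ≤
      n * hullBounds (margOne W) (margTwo W) z t := by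
  have hn' : (0 : ℝ) < n := Nat.cast_pos.2 hn
  have hl : ∀ q, law (chanLaw p x W) (fun ω => x ω.1 q) = law p fun θ => x θ q := fun q =>
    funext fun a => law_chanLaw_comp_fst p x W (fun θ => x θ q) a
  set z := letterPoint p x W m₀ m₁ m₂ with hz
  have hz1 : ∀ q, (z q).1 = law p fun θ => x θ q := hl
  have hmem : ∀ q, (z q).1 ∈ stdSimplex ℝ X := fun q => by
    rw [hz1]
    exact ⟨fun a => law_nonneg hp _ _, by rw [sum_law, hp1]⟩
  have hw1 : ∑ _q : Fin n, (n : ℝ)⁻¹ = 1 := by simp [hn'.ne']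
  have hw0 : ∀ q ∈ (Finset.univ : Finset (Fin n)), (0 : ℝ) ≤ (n : ℝ)⁻¹ := fun _ _ => by positivity
  refine ⟨∑ q, (n : ℝ)⁻¹ • z q, ?_, ?_, fun t => ?_⟩
  · exact (convex_convexHull ℝ _).sum_mem hw0 hw1 fun q _ =>
      letterPoint_mem_auxHull hp hp1 x W m₀ m₁ m₂ q
  · simp only [Prod.fst_sum, Prod.smul_fst, hz1, meanInput]
  · refine (infoBounds_chanLaw_le hp hp1 x W m₀ m₁ m₂ s hs t).trans ?_
    rw [← hz, hullBounds, ← outerBounds_mul hn'.le]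
    have c₁ := (concaveOn_outEnt (margOne_nonneg W)).le_map_sum hw0 hw1 fun q _ => hmem q
    have c₂ := (concaveOn_outEnt (margTwo_nonneg W)).le_map_sum hw0 hw1 fun q _ => hmem q
    have d₁ : ∑ q, outEnt (margOne W) (z q).1 ≤ n * outEnt (margOne W) (∑ q, (n : ℝ)⁻¹ • (z q).1) := by
      refine le_trans (le_of_eq ?_) (mul_le_mul_of_nonneg_left c₁ hn'.le)
      rw [← Finset.smul_sum, smul_eq_mul, mul_inv_cancel_left₀ hn'.ne']
    have d₂ : ∑ q, outEnt (margTwo W) (z q).1 ≤ n * outEnt (margTwo W) (∑ q, (n : ℝ)⁻¹ • (z q).1) := by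
      refine le_trans (le_of_eq ?_) (mul_le_mul_of_nonneg_left c₂ hn'.le)
      rw [← Finset.smul_sum, smul_eq_mul, mul_inv_cancel_left₀ hn'.ne']
    rw [sum_noiseEnt _ hn, sum_noiseEnt _ hn]
    refine outerBounds_mono ?_ ?_ ?_ ?_ ?_ ?_ t
    all_goals
      simp only [Prod.fst_sum, Prod.snd_sum, Prod.smul_fst, Prod.smul_snd, smul_eq_mul,
        ← Finset.mul_sum, mul_sub, mul_inv_cancel_left₀ hn'.ne']
      linarith

end ChannelBlock

/-! ### Product mass functions on blocks. -/

section ProductLaw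

variable {α β : Type*} [Fintype α] [Fintype β] {m : ℕ}

theorem sum_prod_apply {p : Fin m → α → ℝ} (hp : ∀ t, ∑ a, p t a = 1) :
    ∑ x : Fin m → α, ∏ t, p t (x t) = 1 := by
  classical
  rw [← Fintype.piFinset_univ, ← Finset.prod_univ_sum]
  simp [hp]

theorem law_prod_eval {p : Fin m → α → ℝ} (hp : ∀ t, ∑ a, p t a = 1) (t : Fin m) (a : α) :
    law (fun x : Fin m → α => ∏ j, p j (x j)) (fun x => x t) a = p t a := by
  classical
  have h : (Finset.univ.filter fun x : Fin m → α => x t = a) =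
      Fintype.piFinset fun j => if j = t then {a} else Finset.univ := by
    ext x
    simp only [Finset.mem_filter, Finset.mem_univ, true_and, Fintype.mem_piFinset]
    refine ⟨fun h j => ?_, fun h => by simpa using h t⟩
    split_ifs with hj
    · rw [hj, h, Finset.mem_singleton]
    · exact Finset.mem_univ _
  have e : law (fun x : Fin m → α => ∏ j, p j (x j)) (fun x => x t) a =
      ∑ x ∈ Finset.univ.filter (fun x : Fin m → α => x t = a), ∏ j, p j (x j) := by
    rw [law_eq_sum_ite, Finset.sum_filter]
  rw [e, h, ← Finset.prod_univ_sum, Finset.prod_eq_single t]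
  · simp
  · intro j _ hj
    rw [if_neg hj, hp]
  · simp

theorem law_prod_comp (p : α → ℝ) (f : α → β) (y : Fin m → β) :
    law (fun x : Fin m → α => ∏ j, p (x j)) (fun x j => f (x j)) y = ∏ j, law p f (y j) := by
  classical
  have h : (Finset.univ.filter fun x : Fin m → α => (fun j => f (x j)) = y) =
      Fintype.piFinset fun j => Finset.univ.filter fun a => f a = y j := by
    ext x
    simp [funext_iff]
  have e : law (fun x : Fin m → α => ∏ j, p (x j)) (fun x j => f (x j)) y =
      ∑ x ∈ Finset.univ.filter (fun x : Fin m → α => (fun j => f (x j)) = y), ∏ j, p (x j) := by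
    rw [law]
    congr!
  rw [e, h, ← Finset.prod_univ_sum]
  refine Finset.prod_congr rfl fun j _ => ?_
  rw [law_eq_sum_ite, Finset.sum_filter]

theorem sum_negMulLog_prod {p : α → ℝ} (hp : ∑ a, p a = 1) :
    ∑ x : Fin m → α, Real.negMulLog (∏ j, p (x j)) = m * ∑ a, Real.negMulLog (p a) := by
  induction m with
  | zero => simp
  | succ m ih =>
    rw [← (Fin.consEquiv fun _ => α).sum_comp, Fintype.sum_prod_type]
    simp only [Fin.consEquiv_apply, Fin.prod_univ_succ, Fin.cons_zero, Fin.cons_succ,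
      Real.negMulLog_mul, Finset.sum_add_distrib, ← Finset.sum_mul, ← Finset.mul_sum, ih, hp,
      sum_prod_apply fun _ => hp]
    push_cast
    ring

end ProductLaw

/-! ### Single-letterization on the source side. -/

section SourceBlock

variable {Ω E υ α β γ δ : Type*} [Fintype Ω] [Fintype E] [Fintype υ] [Fintype α] [Fintype β]
  [Fintype γ] [Fintype δ] {m : ℕ}

theorem ent_block {P : Ω → ℝ} {pE : E → ℝ} (hE : ∑ x, pE x = 1) {e : Fin m → Ω → E}
    (he : law P (fun ω t => e t ω) = fun x => ∏ t, pE (x t)) (f : E → α) :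
    ent P (fun ω t => f (e t ω)) = m * ent pE f := by
  rw [ent_comp P (fun ω t => e t ω) fun x t => f (x t), he, ent]
  simp only [law_prod_comp]
  exact sum_negMulLog_prod (by rw [sum_law, hE])

theorem condEnt_block {P : Ω → ℝ} {pE : E → ℝ} (hE : ∑ x, pE x = 1) {e : Fin m → Ω → E}
    (he : law P (fun ω t => e t ω) = fun x => ∏ t, pE (x t)) (a : E → α) (c : E → γ) :
    condEnt P (fun ω t => a (e t ω)) (fun ω t => c (e t ω)) = m * condEnt pE a c := by
  rw [condEnt, condEnt, mul_sub, ← ent_block hE he, ← ent_block hE he]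
  congr 1
  refine ent_congr P fun ω ω' => ?_
  simp [funext_iff, forall_and]

/-- The unnormalised mass function obtained by adjoining a time index. -/
def timeLaw (m : ℕ) (P : Ω → ℝ) (ω : Ω × Fin m) : ℝ := P ω.1

theorem law_timeLaw (P : Ω → ℝ) (Z : Fin m → Ω → α) (z : α) :
    law (timeLaw m P) (fun ω => Z ω.2 ω.1) z = ∑ t, law P (Z t) z := by
  classical
  simp only [law_eq_sum_ite, Fintype.sum_prod_type, timeLaw]
  exact Finset.sum_comm

theorem ent_timeLaw_index (P : Ω → ℝ) (Z : Fin m → Ω → α) :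
    ent (timeLaw m P) (fun ω => (ω.2, Z ω.2 ω.1)) = ∑ t, ent P (Z t) := by
  classical
  simp only [ent, Fintype.sum_prod_type]
  refine Finset.sum_congr rfl fun t _ => Finset.sum_congr rfl fun z _ => ?_
  rw [law_timeLaw P (fun t ω => (t, Z t ω)), Finset.sum_eq_single t]
  · congr 1
    exact law_eq_of_iff P (by simp)
  · intro j _ hj
    rw [law_eq_sum_ite]
    simp [hj]
  · simp

theorem condEnt_timeLaw_index (P : Ω → ℝ) (A : Fin m → Ω → α) (C : Fin m → Ω → γ) :
    condEnt (timeLaw m P) (fun ω => A ω.2 ω.1) (fun ω => (ω.2, C ω.2 ω.1)) =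
      ∑ t, condEnt P (A t) (C t) := by
  simp only [condEnt, Finset.sum_sub_distrib, ← ent_timeLaw_index]
  congr 1
  refine ent_congr _ fun ω ω' => ?_
  simp only [Prod.mk.injEq]
  tauto

/-- Since the letters are i.i.d., the entropies of `a` given `c` agree on both sides. In the
equivocation, the chain rule expands the block, and discarding conditioning (past letters, other
`c`, the part of `Y` beyond `g`, finally the time index) only increases it. -/
theorem condMutualInfo_timeLaw_le {P : Ω → ℝ} (hP : ∀ ω, 0 ≤ P ω) {pE : E → ℝ}
    (hE : ∑ x, pE x = 1) {e : Fin m → Ω → E}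
    (he : law P (fun ω t => e t ω) = fun x => ∏ t, pE (x t)) (a : E → α) (c : E → γ)
    (Y : Ω → υ) (g : Fin m → υ → β) :
    condMutualInfo (timeLaw m P) (fun ω => a (e ω.2 ω.1)) (fun ω => g ω.2 (Y ω.1))
      (fun ω => c (e ω.2 ω.1)) ≤
    condMutualInfo P (fun ω t => a (e t ω)) Y (fun ω t => c (e t ω)) := by
  have hP' : ∀ ω, 0 ≤ timeLaw m P ω := fun ω => hP _
  rw [condMutualInfo_eq_left hP', condMutualInfo_eq_left hP, condEnt_block hE he,
    ← sum_condEnt_prefixVar]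
  have h1 : condEnt (timeLaw m P) (fun ω => a (e ω.2 ω.1)) (fun ω => c (e ω.2 ω.1)) =
      m * condEnt pE a c := by
    -- All letters have law `pE`; the factor `m` is the total mass of the unnormalised time-indexed
    -- law.
    have hl : law (timeLaw m P) (fun ω => e ω.2 ω.1) = fun x => (m : ℝ) * pE x := by
      ext x
      have : ∀ t, law P (e t) x = pE x := fun t => by
        rw [law_comp P (fun ω t => e t ω) fun x => x t, he]
        exact law_prod_eval (p := fun _ => pE) (fun _ => hE) t x
      rw [law_timeLaw]
      simp [this]
    rw [condEnt_comp (timeLaw m P) (fun ω => e ω.2 ω.1) a c, hl, condEnt_smul]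
  have h2 : ∑ t, condEnt P (fun ω => a (e t ω)) (fun ω => (prefixVar t (fun t ω => a (e t ω)) ω,
      (Y ω, fun t => c (e t ω)))) ≤
      condEnt (timeLaw m P) (fun ω => a (e ω.2 ω.1))
        (fun ω => (g ω.2 (Y ω.1), c (e ω.2 ω.1))) := by
    -- With the time index in the conditioning, the entropy splits into a sum over times.
    refine le_trans ?_ (condEnt_le_of_determines hP' (fun ω => a (e ω.2 ω.1))
      (D := fun ω => (ω.2, (g ω.2 (Y ω.1), c (e ω.2 ω.1)))) fun ω ω' h => (Prod.mk.inj h).2)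
    rw [condEnt_timeLaw_index P (fun t ω => a (e t ω)) fun t ω => (g t (Y ω), c (e t ω))]
    refine Finset.sum_le_sum fun t _ => condEnt_le_of_determines hP _ fun ω ω' h => ?_
    simp only [Prod.mk.injEq, funext_iff] at h
    rw [h.2.1, h.2.2 t]
  linarith

theorem mul_condMutualInfo_eq {P : Ω → ℝ} (hP : ∀ ω, 0 ≤ P ω) {p : E → ℝ} (hp : ∀ x, 0 ≤ p x)
    {c : ℝ} {Z : Ω → E} (hZ : law P Z = fun x => c * p x) (a : E → α) (b : E → β) (d : E → γ) :
    c * condMutualInfo p a b d =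
      condMutualInfo P (fun ω => a (Z ω)) (fun ω => b (Z ω)) (fun ω => d (Z ω)) := by
  rw [condMutualInfo_eq_left hP, condMutualInfo_eq_left hp, condEnt_comp P Z a d,
    condEnt_comp P Z a fun x => (b x, d x), hZ, condEnt_smul, condEnt_smul, mul_sub]

theorem condMutualInfo_congr_right {P : Ω → ℝ} (hP : ∀ ω, 0 ≤ P ω) (A : Ω → α) (B : Ω → β)
    {C : Ω → γ} {D : Ω → δ} (h : ∀ ω ω', C ω = C ω' ↔ D ω = D ω') :
    condMutualInfo P A B C = condMutualInfo P A B D := by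
  rw [condMutualInfo_eq_left hP, condMutualInfo_eq_left hP]
  congr 1
  · exact condEnt_congr P (fun ω ω' => by simp [h]) h
  · exact condEnt_congr P (fun ω ω' => by simp [h]) fun ω ω' => by simp [h]

end SourceBlock

/-! ### The virtual broadcast channel induced by a code. -/

section VirtualChannel

variable {S X Y₁ Y₂ T T₁ T₂ V₀ V₁ V₂ : Type*} [Fintype S] [Fintype X] [Fintype Y₁] [Fintype Y₂]
  [Fintype T] [Fintype T₁] [Fintype T₂] [Fintype V₀] [Fintype V₁] [Fintype V₂] {m n : ℕ}

/-- Disintegration, with a fixed point mass on null letters; `T` is nonempty because the total mass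
is one. -/
theorem exists_condDist_of_sum_eq (p : ProbDist S) {D : S → T → ℝ} (hD : ∀ s a, 0 ≤ D s a)
    (h : ∀ s, ∑ a, D s a = p s) : ∃ Q : CondDist S T, ∀ s a, p s * Q s a = D s a := by
  classical
  obtain ⟨a₀⟩ : Nonempty T := by
    by_contra hT
    rw [not_nonempty_iff] at hT
    have h1 := stdSimplex.sum_eq_one p
    simp only [← h, Finset.univ_eq_empty, Finset.sum_empty, Finset.sum_const_zero] at h1
    exact zero_ne_one h1
  have : ∀ s, ∃ d : ProbDist T, ∀ a, p s * d a = D s a := by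
    intro s
    rcases (stdSimplex.zero_le p s).eq_or_lt with h0 | h0
    · refine ⟨⟨Pi.single a₀ 1, single_mem_stdSimplex ℝ _⟩, fun a => ?_⟩
      rw [← h0, zero_mul]
      exact ((Finset.sum_eq_zero_iff_of_nonneg fun a _ => hD s a).1 ((h s).trans h0.symm) a
        (Finset.mem_univ a)).symm
    · refine ⟨⟨fun a => D s a / p s, fun a => div_nonneg (hD s a) h0.le, ?_⟩,
        fun a => mul_div_cancel₀ _ h0.ne'⟩
      rw [← Finset.sum_div, h, div_self h0.ne']
  choose Q hQ using this
  exact ⟨Q, hQ⟩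

/-- The law of a memoryless source block and of the channel output block for the encoder `f`. -/
def codeLaw (pS : ProbDist S) (f : (Fin m → S) → Fin n → X) (W : CondDist X (Y₁ × Y₂)) :
    (Fin m → S) × (Fin n → Y₁ × Y₂) → ℝ :=
  chanLaw (fun s => ∏ t, pS (s t)) f W

theorem codeLaw_nonneg (pS : ProbDist S) (f : (Fin m → S) → Fin n → X)
    (W : CondDist X (Y₁ × Y₂)) (ω) : 0 ≤ codeLaw pS f W ω :=
  chanLaw_nonneg (fun _ => Finset.prod_nonneg fun _ _ => stdSimplex.zero_le _ _) _ _ _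

/-- The reconstructions produced by the two decoders at time `t`. -/
def recon (g₁ : (Fin n → Y₁) → Fin m → T₁) (g₂ : (Fin n → Y₂) → Fin m → T₂) (t : Fin m)
    (y : Fin n → Y₁ × Y₂) : T₁ × T₂ :=
  (g₁ (fun q => (y q).1) t, g₂ (fun q => (y q).2) t)

/-- `Q` is the virtual channel from source to reconstruction letters induced by a code. -/
def IsVirtualChannel (pS : ProbDist S) (W : CondDist X (Y₁ × Y₂)) (f : (Fin m → S) → Fin n → X)
    (g₁ : (Fin n → Y₁) → Fin m → T₁) (g₂ : (Fin n → Y₂) → Fin m → T₂)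
    (Q : CondDist S (T₁ × T₂)) : Prop :=
  ∀ s a, m * (pS s * Q s a) =
    ∑ t, law (codeLaw pS f W) (fun ω => (ω.1 t, recon g₁ g₂ t ω.2)) (s, a)

theorem exists_isVirtualChannel (pS : ProbDist S) (W : CondDist X (Y₁ × Y₂))
    (f : (Fin m → S) → Fin n → X) (g₁ : (Fin n → Y₁) → Fin m → T₁)
    (g₂ : (Fin n → Y₂) → Fin m → T₂) (hm : 0 < m) :
    ∃ Q : CondDist S (T₁ × T₂), IsVirtualChannel pS W f g₁ g₂ Q := by
  have hm' : (m : ℝ) ≠ 0 := Nat.cast_ne_zero.2 hm.ne'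
  obtain ⟨Q, hQ⟩ := exists_condDist_of_sum_eq pS (D := fun s a => (m : ℝ)⁻¹ *
    ∑ t, law (codeLaw pS f W) (fun ω => (ω.1 t, recon g₁ g₂ t ω.2)) (s, a))
    (fun s a => mul_nonneg (by positivity) (Finset.sum_nonneg fun t _ =>
      law_nonneg (codeLaw_nonneg pS f W) _ _)) fun s => by
      rw [← Finset.mul_sum, Finset.sum_comm]
      simp only [sum_law_pair_right]
      have : ∀ t, law (codeLaw pS f W) (fun ω => ω.1 t) s = pS s := fun t => by
        rw [codeLaw, law_chanLaw_comp_fst _ _ _ fun s : Fin m → S => s t]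
        exact law_prod_eval (p := fun _ s => pS s) (fun _ => stdSimplex.sum_eq_one pS) t s
      simp [this, hm']
  exact ⟨Q, fun s a => by rw [hQ, mul_inv_cancel_left₀ hm']⟩

theorem sum_blockLaw (pS : ProbDist S) (W : CondDist X (Y₁ × Y₂)) (f : (Fin m → S) → Fin n → X)
    (F : (Fin m → S) → (Fin n → Y₁) → (Fin n → Y₂) → ℝ) :
    ∑ ω, blockLaw pS W f ω * F ω.1 ω.2.1 ω.2.2 =
      ∑ ω, codeLaw pS f W ω * F ω.1 (fun q => (ω.2 q).1) fun q => (ω.2 q).2 := by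
  rw [Fintype.sum_prod_type, Fintype.sum_prod_type]
  refine Finset.sum_congr rfl fun s _ => ?_
  rw [← (Equiv.arrowProdEquivProdArrow (Fin n) (fun _ => Y₁) (fun _ => Y₂)).sum_comp]
  rfl

theorem IsVirtualChannel.sum_mul_eq {pS : ProbDist S} {W : CondDist X (Y₁ × Y₂)}
    {f : (Fin m → S) → Fin n → X} {g₁ : (Fin n → Y₁) → Fin m → T₁}
    {g₂ : (Fin n → Y₂) → Fin m → T₂} {Q : CondDist S (T₁ × T₂)}
    (h : IsVirtualChannel pS W f g₁ g₂ Q) (hm : 0 < m) (w : S → T₁ × T₂ → ℝ) :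
    ∑ s, ∑ a, pS s * Q s a * w s a =
      1 / (m : ℝ) * ∑ t, ∑ ω, blockLaw pS W f ω * w (ω.1 t) (g₁ ω.2.1 t, g₂ ω.2.2 t) := by
  have hm' : (m : ℝ) ≠ 0 := Nat.cast_ne_zero.2 hm.ne'
  have h' : ∀ t, ∑ ω, blockLaw pS W f ω * w (ω.1 t) (g₁ ω.2.1 t, g₂ ω.2.2 t) =
      ∑ z : S × T₁ × T₂,
        law (codeLaw pS f W) (fun ω => (ω.1 t, recon g₁ g₂ t ω.2)) z * w z.1 z.2 := by
    intro t
    rw [sum_blockLaw pS W f fun s y₁ y₂ => w (s t) (g₁ y₁ t, g₂ y₂ t),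
      sum_law_mul (codeLaw pS f W) (fun ω => (ω.1 t, recon g₁ g₂ t ω.2)) fun z => w z.1 z.2]
    rfl
  simp only [h']
  rw [one_div, eq_inv_mul_iff_mul_eq₀ hm', ← Fintype.sum_prod_type' fun s a =>
    pS s * Q s a * w s a, Finset.mul_sum, Finset.sum_comm (s := (Finset.univ : Finset (Fin m)))]
  refine Finset.sum_congr rfl fun z _ => ?_
  rw [← Finset.sum_mul, ← mul_assoc, h]

/-- The law of a source letter with its auxiliary letters. -/
def letterLaw (q : CondDist S (V₀ × V₁ × V₂)) (pS : ProbDist S) (e : (V₀ × V₁ × V₂) × S) : ℝ :=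
  q e.2 e.1 * pS e.2

theorem letterLaw_nonneg (q : CondDist S (V₀ × V₁ × V₂)) (pS : ProbDist S) (e) :
    0 ≤ letterLaw q pS e :=
  mul_nonneg (stdSimplex.zero_le _ _) (stdSimplex.zero_le _ _)

theorem sum_letterLaw (q : CondDist S (V₀ × V₁ × V₂)) (pS : ProbDist S) :
    ∑ e, letterLaw q pS e = 1 := by
  rw [Fintype.sum_prod_type, Finset.sum_comm]
  simp only [letterLaw, ← Finset.sum_mul, stdSimplex.sum_eq_one, one_mul]

/-- The law of a block of source letters with auxiliary letters and of the channel output. -/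
def auxCodeLaw (q : CondDist S (V₀ × V₁ × V₂)) (pS : ProbDist S) (f : (Fin m → S) → Fin n → X)
    (W : CondDist X (Y₁ × Y₂)) : (Fin m → (V₀ × V₁ × V₂) × S) × (Fin n → Y₁ × Y₂) → ℝ :=
  chanLaw (fun θ => ∏ t, letterLaw q pS (θ t)) (fun θ => f fun t => (θ t).2) W

/-- The encoder ignores the auxiliaries, and the auxiliary letter at time `t` depends on everything
else only through the source letter at time `t`. Hence auxiliary letter, source letter and any
function of the output form a Markov chain. -/
theorem law_auxCodeLaw (q : CondDist S (V₀ × V₁ × V₂)) (pS : ProbDist S)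
    (f : (Fin m → S) → Fin n → X) (W : CondDist X (Y₁ × Y₂)) (t : Fin m)
    (b : (Fin n → Y₁ × Y₂) → T) (v : V₀ × V₁ × V₂) (s : S) (a : T) :
    law (auxCodeLaw q pS f W) (fun ω => ((ω.1 t).1, (ω.1 t).2, b ω.2)) (v, s, a) =
      q s v * law (codeLaw pS f W) (fun ω => (ω.1 t, b ω.2)) (s, a) := by
  classical
  rw [law_eq_sum_ite, law_eq_sum_ite, Fintype.sum_prod_type, Fintype.sum_prod_type,
    ← (Equiv.arrowProdEquivProdArrow (Fin m) (fun _ => V₀ × V₁ × V₂) (fun _ => S)).symm.sum_comp,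
    Fintype.sum_prod_type, Finset.sum_comm, Finset.mul_sum]
  refine Finset.sum_congr rfl fun s' _ => ?_
  rw [Finset.sum_comm, Finset.mul_sum]
  refine Finset.sum_congr rfl fun y _ => ?_
  by_cases h : s' t = s ∧ b y = a
  · have e := law_prod_eval (p := fun j v => q (s' j) v)
      (fun j => stdSimplex.sum_eq_one (q (s' j))) t v
    rw [h.1, law_eq_sum_ite] at e
    rw [← e, Finset.sum_mul]
    refine Finset.sum_congr rfl fun v' _ => ?_
    simp only [Equiv.arrowProdEquivProdArrow, Equiv.coe_fn_symm_mk, Prod.mk.injEq, h, and_true,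
      auxCodeLaw, codeLaw, chanLaw, letterLaw, Finset.prod_mul_distrib, if_true, ite_mul, zero_mul,
      mul_assoc]
  · rw [Finset.sum_eq_zero, if_neg (by simpa using h), mul_zero]
    intro v' _
    rw [if_neg]
    simp only [Equiv.arrowProdEquivProdArrow, Equiv.coe_fn_symm_mk, Prod.mk.injEq]
    tauto

theorem auxCodeLaw_nonneg (q : CondDist S (V₀ × V₁ × V₂)) (pS : ProbDist S)
    (f : (Fin m → S) → Fin n → X) (W : CondDist X (Y₁ × Y₂)) (ω) : 0 ≤ auxCodeLaw q pS f W ω :=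
  chanLaw_nonneg (fun _ => Finset.prod_nonneg fun _ _ => letterLaw_nonneg q pS _) _ _ _

theorem sum_auxCodeLaw (q : CondDist S (V₀ × V₁ × V₂)) (pS : ProbDist S)
    (f : (Fin m → S) → Fin n → X) (W : CondDist X (Y₁ × Y₂)) :
    ∑ ω, auxCodeLaw q pS f W ω = 1 := by
  rw [auxCodeLaw, sum_chanLaw]
  exact sum_prod_apply fun _ => sum_letterLaw q pS

theorem law_auxCodeLaw_letters (q : CondDist S (V₀ × V₁ × V₂)) (pS : ProbDist S)
    (f : (Fin m → S) → Fin n → X) (W : CondDist X (Y₁ × Y₂)) :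
    law (auxCodeLaw q pS f W) (fun ω t => ω.1 t) = fun x => ∏ t, letterLaw q pS (x t) := by
  classical
  ext x
  refine (law_chanLaw_comp_fst _ _ _ (fun θ : Fin m → (V₀ × V₁ × V₂) × S => θ) x).trans ?_
  rw [law_eq_sum_ite]
  exact (Finset.sum_eq_single x (fun y _ hy => if_neg hy) (by simp)).trans (if_pos rfl)

/-- The Markov factor `q s v` does not depend on time, so it leaves the sum over times and what
remains is the definition of `Q`. -/
theorem IsVirtualChannel.law_timeLaw_eq {pS : ProbDist S} {W : CondDist X (Y₁ × Y₂)}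
    {f : (Fin m → S) → Fin n → X} {g₁ : (Fin n → Y₁) → Fin m → T₁}
    {g₂ : (Fin n → Y₂) → Fin m → T₂} {Q : CondDist S (T₁ × T₂)}
    (h : IsVirtualChannel pS W f g₁ g₂ Q) (q : CondDist S (V₀ × V₁ × V₂)) :
    law (timeLaw m (auxCodeLaw q pS f W))
      (fun ω => ((ω.1.1 ω.2).1, (ω.1.1 ω.2).2, recon g₁ g₂ ω.2 ω.1.2)) =
      fun x => (m : ℝ) * testLaw q pS Q x := by
  ext ⟨v, s, a⟩
  refine (law_timeLaw (auxCodeLaw q pS f W)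
    (fun t ω => ((ω.1 t).1, (ω.1 t).2, recon g₁ g₂ t ω.2)) _).trans ?_
  simp only [law_auxCodeLaw, ← Finset.mul_sum, ← h s a, testLaw]
  ring

theorem IsVirtualChannel.mul_condMutualInfo_one_le {α γ : Type*} [Fintype α] [Fintype γ]
    {pS : ProbDist S} {W : CondDist X (Y₁ × Y₂)}
    {f : (Fin m → S) → Fin n → X} {g₁ : (Fin n → Y₁) → Fin m → T₁}
    {g₂ : (Fin n → Y₂) → Fin m → T₂} {Q : CondDist S (T₁ × T₂)}
    (h : IsVirtualChannel pS W f g₁ g₂ Q) (q : CondDist S (V₀ × V₁ × V₂))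
    (a : (V₀ × V₁ × V₂) × S → α) (c : (V₀ × V₁ × V₂) × S → γ) :
    m * condMutualInfo (testLaw q pS Q) (fun ω => a (ω.1, ω.2.1)) (fun ω => ω.2.2.1)
        (fun ω => c (ω.1, ω.2.1)) ≤
      condMutualInfo (auxCodeLaw q pS f W) (fun ω j => a (ω.1 j)) (fun ω q => outOne q ω)
        (fun ω j => c (ω.1 j)) := by
  rw [mul_condMutualInfo_eq (fun ω => auxCodeLaw_nonneg q pS f W _) (testLaw_nonneg q pS Q)
    (h.law_timeLaw_eq q)]
  exact condMutualInfo_timeLaw_le (auxCodeLaw_nonneg q pS f W) (sum_letterLaw q pS)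
    (law_auxCodeLaw_letters q pS f W) a c (fun ω q => outOne q ω) fun t y => g₁ y t

theorem IsVirtualChannel.mul_condMutualInfo_two_le {α γ : Type*} [Fintype α] [Fintype γ]
    {pS : ProbDist S} {W : CondDist X (Y₁ × Y₂)}
    {f : (Fin m → S) → Fin n → X} {g₁ : (Fin n → Y₁) → Fin m → T₁}
    {g₂ : (Fin n → Y₂) → Fin m → T₂} {Q : CondDist S (T₁ × T₂)}
    (h : IsVirtualChannel pS W f g₁ g₂ Q) (q : CondDist S (V₀ × V₁ × V₂))
    (a : (V₀ × V₁ × V₂) × S → α) (c : (V₀ × V₁ × V₂) × S → γ) :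
    m * condMutualInfo (testLaw q pS Q) (fun ω => a (ω.1, ω.2.1)) (fun ω => ω.2.2.2)
        (fun ω => c (ω.1, ω.2.1)) ≤
      condMutualInfo (auxCodeLaw q pS f W) (fun ω j => a (ω.1 j)) (fun ω q => outTwo q ω)
        (fun ω j => c (ω.1 j)) := by
  rw [mul_condMutualInfo_eq (fun ω => auxCodeLaw_nonneg q pS f W _) (testLaw_nonneg q pS Q)
    (h.law_timeLaw_eq q)]
  exact condMutualInfo_timeLaw_le (auxCodeLaw_nonneg q pS f W) (sum_letterLaw q pS)
    (law_auxCodeLaw_letters q pS f W) a c (fun ω q => outTwo q ω) fun t y => g₂ y t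

theorem IsVirtualChannel.mul_testBounds_le {pS : ProbDist S} {W : CondDist X (Y₁ × Y₂)}
    {f : (Fin m → S) → Fin n → X} {g₁ : (Fin n → Y₁) → Fin m → T₁}
    {g₂ : (Fin n → Y₂) → Fin m → T₂} {Q : CondDist S (T₁ × T₂)}
    (h : IsVirtualChannel pS W f g₁ g₂ Q) (q : CondDist S (V₀ × V₁ × V₂)) (t : Fin 5) :
    m * testBounds q pS Q t ≤
      infoBounds (auxCodeLaw q pS f W) (fun ω j => (ω.1 j).1.1) (fun ω j => (ω.1 j).1.2.1)
        (fun ω j => (ω.1 j).1.2.2) (fun ω j => (ω.1 j).2) (fun ω q => outOne q ω)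
        (fun ω q => outTwo q ω) t := by
  have hP := auxCodeLaw_nonneg q pS f W
  have hP1 := sum_auxCodeLaw q pS f W
  have hT1 := sum_testLaw q pS Q
  rw [testBounds, infoBounds, infoBounds, ← outerBounds_mul (Nat.cast_nonneg m)]
  rw [mutualInfo_eq_condMutualInfo hT1, mutualInfo_eq_condMutualInfo hT1,
    mutualInfo_eq_condMutualInfo hP1, mutualInfo_eq_condMutualInfo hP1]
  refine outerBounds_mono ?_ ?_ ?_ ?_ ?_ ?_ t
  · refine (h.mul_condMutualInfo_one_le q (fun e => e.1.1) fun _ => ()).trans_eq ?_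
    exact condMutualInfo_congr_right hP _ _ (by simp)
  · refine (h.mul_condMutualInfo_two_le q (fun e => e.1.1) fun _ => ()).trans_eq ?_
    exact condMutualInfo_congr_right hP _ _ (by simp)
  · exact h.mul_condMutualInfo_one_le q (fun e => e.1.2.1) fun e => e.1.1
  · exact h.mul_condMutualInfo_two_le q (fun e => e.1.2.2) fun e => e.1.1
  · refine (h.mul_condMutualInfo_two_le q (fun e => e.2) fun e => (e.1.1, e.1.2.1)).trans_eq ?_
    exact condMutualInfo_congr_right hP _ _ (by simp [funext_iff, forall_and])
  · refine (h.mul_condMutualInfo_one_le q (fun e => e.2) fun e => (e.1.1, e.1.2.2)).trans_eq ?_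
    exact condMutualInfo_congr_right hP _ _ (by simp [funext_iff, forall_and])

end VirtualChannel

/-! ### The finite-blocklength converse. -/

section SingleLetter

variable {Ω A₀ A₁ A₂ N B₁ B₂ : Type*} [Fintype Ω] [Fintype A₀] [Fintype A₁] [Fintype A₂]
  [Fintype N] [Fintype B₁] [Fintype B₂]

theorem infoBounds_nonneg {P : Ω → ℝ} (hP : ∀ ω, 0 ≤ P ω) (h1 : ∑ ω, P ω = 1) (a₀ : Ω → A₀)
    (a₁ : Ω → A₁) (a₂ : Ω → A₂) (x : Ω → N) (b₁ : Ω → B₁) (b₂ : Ω → B₂) (t : Fin 5) :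
    0 ≤ infoBounds P a₀ a₁ a₂ x b₁ b₂ t := by
  rw [infoBounds, mutualInfo_eq_condMutualInfo h1, mutualInfo_eq_condMutualInfo h1]
  exact outerBounds_nonneg (condMutualInfo_nonneg hP _ _ _) (condMutualInfo_nonneg hP _ _ _)
    (condMutualInfo_nonneg hP _ _ _) (condMutualInfo_nonneg hP _ _ _)
    (condMutualInfo_nonneg hP _ _ _) (condMutualInfo_nonneg hP _ _ _) t

theorem continuous_condEnt (a : Ω → A₀) (c : Ω → A₁) :
    Continuous fun P : Ω → ℝ => condEnt P a c := by
  unfold condEnt ent law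
  fun_prop

variable {S X Y₁ Y₂ T₁ T₂ V₀ V₁ V₂ : Type*} [Fintype S] [Fintype X] [Fintype Y₁] [Fintype Y₂]
  [Fintype T₁] [Fintype T₂] [Fintype V₀] [Fintype V₁] [Fintype V₂] {m n : ℕ}

theorem continuous_condDist_apply {S T : Type*} [Fintype T] (s : S) (a : T) :
    Continuous fun Q : CondDist S T => Q s a :=
  (continuous_apply a).comp (continuous_subtype_val.comp (continuous_apply s))

/-- The entropy form is needed here: `negMulLog` is continuous at zero, whereas the logarithms of
quotients defining information are not evidently so. -/
theorem continuous_testBounds (q : CondDist S (V₀ × V₁ × V₂)) (pS : ProbDist S) (t : Fin 5) :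
    Continuous fun Q : CondDist S (T₁ × T₂) => testBounds q pS Q t := by
  have hlaw : Continuous fun Q : CondDist S (T₁ × T₂) => testLaw q pS Q :=
    continuous_pi fun ω => continuous_const.mul (continuous_condDist_apply ω.2.1 ω.2.2)
  have e : (fun Q : CondDist S (T₁ × T₂) => testBounds q pS Q t) = fun Q => _ := funext fun Q => by
    rw [testBounds, infoBounds_eq (testLaw_nonneg q pS Q) (sum_testLaw q pS Q)]
  rw [e]
  refine (continuous_outerBounds t).comp ((Continuous.sub ?_ ?_).prodMk
    ((Continuous.sub ?_ ?_).prodMk ((Continuous.sub ?_ ?_).prodMk ((Continuous.sub ?_ ?_).prodMk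
    ((Continuous.sub ?_ ?_).prodMk (Continuous.sub ?_ ?_))))))
  all_goals exact (continuous_condEnt _ _).comp hlaw

/-- This makes the input law of the converse independent of the test channel `q`. -/
theorem meanInput_letterLaw (q : CondDist S (V₀ × V₁ × V₂)) (pS : ProbDist S)
    (f : (Fin m → S) → Fin n → X) :
    meanInput (fun θ : Fin m → (V₀ × V₁ × V₂) × S => ∏ t, letterLaw q pS (θ t))
      (fun θ => f fun t => (θ t).2) = meanInput (fun s => ∏ t, pS (s t)) f := by
  classical
  have hsnd : law (letterLaw q pS) Prod.snd = pS := by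
    ext s
    rw [law_eq_sum_ite, Fintype.sum_prod_type, Finset.sum_comm,
      Finset.sum_eq_single s (fun s' _ h => by simp [h]) (by simp)]
    simp only [if_true, letterLaw, ← Finset.sum_mul, stdSimplex.sum_eq_one, one_mul]
  have h : law (fun θ : Fin m → (V₀ × V₁ × V₂) × S => ∏ t, letterLaw q pS (θ t))
      (fun θ t => (θ t).2) = fun s => ∏ t, pS (s t) := by
    ext s
    rw [law_prod_comp (letterLaw q pS) Prod.snd, hsnd]
  simp only [meanInput]
  refine Finset.sum_congr rfl fun j _ => ?_
  congr 1
  ext a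
  rw [law_comp _ (fun (θ : Fin m → (V₀ × V₁ × V₂) × S) t => (θ t).2) fun s => f s j, h]

/-- Serves codes with `n = 0`, which have no mean input. The point comes from one use of the channel
with a constant input. -/
theorem exists_hullBounds_nonneg [Nonempty X] (W : CondDist X (Y₁ × Y₂)) :
    ∃ pX : ProbDist X, ∃ z ∈ auxHull (margOne W) (margTwo W), z.1 = pX ∧
      ∀ t, 0 ≤ hullBounds (margOne W) (margTwo W) z t := by
  obtain ⟨x₀⟩ := ‹Nonempty X›
  have hp : ∀ θ : Unit, (0 : ℝ) ≤ (fun _ => 1) θ := fun _ => zero_le_one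
  have hp1 : ∑ θ : Unit, (fun _ => (1 : ℝ)) θ = 1 := by simp
  obtain ⟨z, hz, hz1, h⟩ := exists_infoBounds_chanLaw_le hp hp1
    (fun _ (_ : Fin 1) => x₀) one_pos W (fun _ => ()) (fun _ => ()) (fun _ => ()) (fun _ => ())
    fun _ _ _ => rfl
  refine ⟨⟨_, meanInput_mem_stdSimplex hp hp1 (fun _ (_ : Fin 1) => x₀) one_pos⟩, z, hz, hz1,
    fun t => ?_⟩
  have := (infoBounds_nonneg (chanLaw_nonneg hp _ W) (by rw [sum_chanLaw, hp1]) _ _ _ _ _ _ t).trans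
    (h t)
  simpa using this

/-- The finite-blocklength converse: the source region is dominated by the channel region. -/
theorem exists_virtualChannel_bounds [Nonempty X] (pS : ProbDist S) (W : CondDist X (Y₁ × Y₂))
    (f : (Fin m → S) → Fin n → X) (g₁ : (Fin n → Y₁) → Fin m → T₁)
    (g₂ : (Fin n → Y₂) → Fin m → T₂) (hm : 0 < m) :
    ∃ (Q : CondDist S (T₁ × T₂)) (pX : ProbDist X), IsVirtualChannel pS W f g₁ g₂ Q ∧
      ∀ (k₀ k₁ k₂ : ℕ) (q : CondDist S (Fin k₀ × Fin k₁ × Fin k₂)),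
        ∃ z ∈ auxHull (margOne W) (margTwo W), z.1 = pX ∧ ∀ t,
          0 ≤ hullBounds (margOne W) (margTwo W) z t ∧
          testBounds q pS Q t ≤ n / m * hullBounds (margOne W) (margTwo W) z t := by
  have hm' : (0 : ℝ) < m := Nat.cast_pos.2 hm
  obtain ⟨Q, hQ⟩ := exists_isVirtualChannel pS W f g₁ g₂ hm
  have hθ : ∀ {k₀ k₁ k₂ : ℕ} (q : CondDist S (Fin k₀ × Fin k₁ × Fin k₂))
      (θ : Fin m → (Fin k₀ × Fin k₁ × Fin k₂) × S), 0 ≤ ∏ t, letterLaw q pS (θ t) := fun q θ =>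
    Finset.prod_nonneg fun _ _ => letterLaw_nonneg q pS _
  have hθ1 : ∀ {k₀ k₁ k₂ : ℕ} (q : CondDist S (Fin k₀ × Fin k₁ × Fin k₂)),
      ∑ θ : Fin m → (Fin k₀ × Fin k₁ × Fin k₂) × S, ∏ t, letterLaw q pS (θ t) = 1 := fun q =>
    sum_prod_apply fun _ => sum_letterLaw q pS
  have hs : ∀ {k₀ k₁ k₂ : ℕ} (θ θ' : Fin m → (Fin k₀ × Fin k₁ × Fin k₂) × S),
      (fun j => (θ j).2) = (fun j => (θ' j).2) →
        f (fun j => (θ j).2) = f (fun j => (θ' j).2) := fun _ _ h => by rw [h]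
  -- Without channel uses all sums over time are empty, so the source bounds are at most zero and
  -- any nonnegative hull point serves.
  rcases Nat.eq_zero_or_pos n with rfl | hn
  · obtain ⟨pX, z, hz, hzX, h0⟩ := exists_hullBounds_nonneg W
    refine ⟨Q, pX, hQ, fun k₀ k₁ k₂ q => ⟨z, hz, hzX, fun t => ⟨h0 t, ?_⟩⟩⟩
    have h1 := hQ.mul_testBounds_le q t
    have h2 := infoBounds_chanLaw_le (hθ q) (hθ1 q) (fun θ => f fun t => (θ t).2) W
      (fun θ j => (θ j).1.1) (fun θ j => (θ j).1.2.1) (fun θ j => (θ j).1.2.2)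
      (fun θ j => (θ j).2) hs t
    have h3 := outerBounds_mul le_rfl 0 0 0 0 0 0 t
    simp only [Finset.univ_eq_empty, Finset.sum_empty, sub_zero] at h2
    simp only [zero_mul] at h3
    rw [h3] at h2
    simp only [CharP.cast_eq_zero, zero_div, zero_mul]
    exact nonpos_of_mul_nonpos_right (h1.trans h2) hm'
  · have hsum : ∑ s : Fin m → S, ∏ t, pS (s t) = 1 :=
      sum_prod_apply (p := fun _ s => pS s) fun _ => stdSimplex.sum_eq_one pS
    refine ⟨Q, ⟨_, meanInput_mem_stdSimplex (p := fun s => ∏ t, pS (s t))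
      (fun _ => Finset.prod_nonneg fun _ _ => stdSimplex.zero_le _ _) hsum f hn⟩, hQ,
      fun k₀ k₁ k₂ q => ?_⟩
    obtain ⟨z, hz, hzX, h⟩ := exists_infoBounds_chanLaw_le (hθ q) (hθ1 q)
      (fun θ => f fun t => (θ t).2) hn W
      (fun θ j => (θ j).1.1) (fun θ j => (θ j).1.2.1) (fun θ j => (θ j).1.2.2)
      (fun θ j => (θ j).2) hs
    refine ⟨z, hz, hzX.trans (meanInput_letterLaw q pS f), fun t => ⟨?_, ?_⟩⟩
    · have h0 := (infoBounds_nonneg (auxCodeLaw_nonneg q pS f W) (sum_auxCodeLaw q pS f W)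
        _ _ _ _ _ _ t).trans (h t)
      exact nonneg_of_mul_nonneg_right h0 (Nat.cast_pos.2 hn)
    · rw [div_mul_eq_mul_div, le_div_iff₀ hm', mul_comm]
      exact (hQ.mul_testBounds_le q t).trans (h t)

end SingleLetter

/-! ### Scaled regions and the limit of codes. -/

theorem mem_smul_outerRegion {X Y₁ Y₂ : Type*} [Fintype X] [Fintype Y₁] [Fintype Y₂]
    {pX : ProbDist X} {W : CondDist X (Y₁ × Y₂)} {κ : ℝ} (hκ : 0 ≤ κ) {k₀ k₁ k₂ : ℕ}
    (q : CondDist X (Fin k₀ × Fin k₁ × Fin k₂)) {R : ℝ × ℝ × ℝ} (h₀ : 0 ≤ R.1) (h₁ : 0 ≤ R.2.1)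
    (h₂ : 0 ≤ R.2.2) (h : ∀ t, ![R.1, R.1 + R.2.1, R.1 + R.2.2, R.1 + R.2.1 + R.2.2,
      R.1 + R.2.1 + R.2.2] t ≤ κ * testBounds q pX W t) :
    R ∈ κ • outerRegion pX W := by
  obtain ⟨R₀, R₁, R₂⟩ := R
  rcases hκ.eq_or_lt with rfl | hκ
  -- Scaling by zero cannot be undone, but here the second and third inequalities force the rate
  -- triple to be zero, and zero rates lie in the region.
  · have e₁ := h 1
    have e₂ := h 2
    simp only [Fin.isValue, Matrix.cons_val, zero_mul] at e₁ e₂ h₀ h₁ h₂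
    refine ⟨0, ⟨k₀, k₁, k₂, q, ?_⟩, ?_⟩
    · rw [outerConstraints_iff]
      refine ⟨le_rfl, le_rfl, le_rfl, fun t => ?_⟩
      have := infoBounds_nonneg (testLaw_nonneg q pX W) (sum_testLaw q pX W)
        (fun ω => ω.1.1) (fun ω => ω.1.2.1) (fun ω => ω.1.2.2)
        (fun ω => ω.2.1) (fun ω => ω.2.2.1) (fun ω => ω.2.2.2) t
      refine le_trans (le_of_eq ?_) this
      fin_cases t <;> simp
    · simp only [Prod.ext_iff]
      refine ⟨?_, ?_, ?_⟩ <;> simp <;> linarith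
  · refine ⟨κ⁻¹ • (R₀, R₁, R₂), ⟨k₀, k₁, k₂, q, ?_⟩, smul_inv_smul₀ hκ.ne' _⟩
    rw [outerConstraints_iff]
    have hi := inv_nonneg.2 hκ.le
    refine ⟨mul_nonneg hi h₀, mul_nonneg hi h₁, mul_nonneg hi h₂, fun t => ?_⟩
    have ht := mul_le_mul_of_nonneg_left (h t) hi
    rw [inv_mul_cancel_left₀ hκ.ne'] at ht
    refine le_trans (le_of_eq ?_) ht
    fin_cases t <;> simp [mul_add]

end LossyBroadcast

end

open LossyBroadcast
theorem corollary1 {S X Y₁ Y₂ T₁ T₂ : Type*} [Fintype S] [Fintype X] [Nonempty X]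
    [Fintype Y₁] [Fintype Y₂] [Fintype T₁] [Fintype T₂]
    (pS : ProbDist S) (W : CondDist X (Y₁ × Y₂))
    (w₁ : S → T₁ → ℝ≥0) (w₂ : S → T₂ → ℝ≥0) (κ d₁ d₂ : ℝ)
    (hach : Achievable pS W w₁ w₂ κ d₁ d₂) :
    ∃ Q : CondDist S (T₁ × T₂),
      (∑ s, ∑ a, pS s * Q s a * (w₁ s a.1 : ℝ) ≤ d₁) ∧
      (∑ s, ∑ a, pS s * Q s a * (w₂ s a.2 : ℝ) ≤ d₂) ∧
      ∃ pX : ProbDist X, outerRegion pS Q ⊆ κ • outerRegion pX W := by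
  have hcode : ∀ N : ℕ, ∃ (Q : CondDist S (T₁ × T₂)) (pX : ProbDist X) (ρ : ℝ),
      (∑ s, ∑ a, pS s * Q s a * (w₁ s a.1 : ℝ) ≤ d₁ + 1 / ((N : ℝ) + 1)) ∧
      (∑ s, ∑ a, pS s * Q s a * (w₂ s a.2 : ℝ) ≤ d₂ + 1 / ((N : ℝ) + 1)) ∧
      0 ≤ ρ ∧ ρ ≤ κ + 1 / ((N : ℝ) + 1) ∧
      ∀ (k₀ k₁ k₂ : ℕ) (q : CondDist S (Fin k₀ × Fin k₁ × Fin k₂)),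
        ∃ z ∈ auxHull (margOne W) (margTwo W), z.1 = pX ∧ ∀ t,
          0 ≤ hullBounds (margOne W) (margTwo W) z t ∧
          testBounds q pS Q t ≤ ρ * hullBounds (margOne W) (margTwo W) z t := by
    intro N
    obtain ⟨m, n, f, g₁, g₂, hm, hρ, h₁, h₂⟩ := hach (1 / ((N : ℝ) + 1)) (by positivity)
    obtain ⟨Q, pX, hQ, h⟩ := exists_virtualChannel_bounds pS W f g₁ g₂ hm
    refine ⟨Q, pX, n / m, ?_, ?_, by positivity, hρ, h⟩
    · rwa [hQ.sum_mul_eq hm fun s a => (w₁ s a.1 : ℝ)]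
    · rwa [hQ.sum_mul_eq hm fun s a => (w₂ s a.2 : ℝ)]
  choose Q pX ρ hd₁ hd₂ hρ0 hρ hz using hcode
  -- `Q'` and `pX'` must be fixed before the test channel, whereas the hull points depend on it.
  -- Along a single ultrafilter all of them converge, and no further subsequence is needed.
  set U : Filter ℕ := (Filter.hyperfilter ℕ : Filter ℕ) with hU
  have hε : Filter.Tendsto (fun N : ℕ => 1 / ((N : ℝ) + 1)) U (nhds 0) :=
    tendsto_one_div_add_atTop_nhds_zero_nat.mono_left Nat.hyperfilter_le_atTop
  have hκ : Filter.Tendsto (fun N : ℕ => κ + 1 / ((N : ℝ) + 1)) U (nhds κ) := by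
    simpa using hε.const_add κ
  have hκ0 : 0 ≤ κ := ge_of_tendsto' hκ fun N => (hρ0 N).trans (hρ N)
  obtain ⟨Q', -, hQ'⟩ := isCompact_univ.ultrafilter_le_nhds
    ((Filter.hyperfilter ℕ).map Q) (by simp)
  obtain ⟨pX', -, hpX'⟩ := isCompact_univ.ultrafilter_le_nhds
    ((Filter.hyperfilter ℕ).map pX) (by simp)
  have hQt : Filter.Tendsto Q U (nhds Q') := hQ'
  have hpXt : Filter.Tendsto pX U (nhds pX') := hpX'
  have hdist : ∀ (w : S → T₁ × T₂ → ℝ) (d : ℝ),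
      (∀ N : ℕ, ∑ s, ∑ a, pS s * Q N s a * w s a ≤ d + 1 / ((N : ℝ) + 1)) →
      ∑ s, ∑ a, pS s * Q' s a * w s a ≤ d := by
    intro w d h
    have hc : Continuous fun Q : CondDist S (T₁ × T₂) => ∑ s, ∑ a, pS s * Q s a * w s a :=
      continuous_finsetSum _ fun s _ => continuous_finsetSum _ fun a _ =>
        (continuous_const.mul (continuous_condDist_apply s a)).mul continuous_const
    refine le_of_tendsto_of_tendsto' ((hc.tendsto Q').comp hQt) ?_ h
    simpa using hε.const_add d
  refine ⟨Q', hdist (fun s a => w₁ s a.1) d₁ hd₁, hdist (fun s a => w₂ s a.2) d₂ hd₂, pX', ?_⟩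
  rintro R ⟨k₀, k₁, k₂, q, hR⟩
  rw [outerConstraints_iff] at hR
  obtain ⟨h₀, h₁, h₂, hR⟩ := hR
  have hzq := fun N => hz N k₀ k₁ k₂ q
  choose z hzmem hzX hzb using hzq
  obtain ⟨z', hz'mem, hz'⟩ := isCompact_auxHull.ultrafilter_le_nhds
    ((Filter.hyperfilter ℕ).map z)
    (Filter.le_principal_iff.2 (Filter.mem_map.2 (Filter.univ_mem' hzmem)))
  have hzt : Filter.Tendsto z U (nhds z') := hz'
  have hz'X : z'.1 = pX' := by
    refine tendsto_nhds_unique ((continuous_fst.tendsto z').comp hzt) ?_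
    have : Prod.fst ∘ z = fun N => (pX N : X → ℝ) := funext hzX
    rw [this]
    exact (continuous_subtype_val.tendsto pX').comp hpXt
  obtain ⟨l₀, l₁, l₂, q', hq'⟩ := exists_testBounds_eq W pX' hz'mem hz'X
  refine mem_smul_outerRegion hκ0 q' h₀ h₁ h₂ fun t => (hR t).trans ?_
  rw [hq']
  refine le_of_tendsto_of_tendsto' (((continuous_testBounds q pS t).tendsto Q').comp hQt)
    (hκ.mul (((continuous_hullBounds (margOne W) (margTwo W) t).tendsto z').comp hzt)) fun N => ?_
  -- Nonnegativity of the hull bounds allows the ratio `ρ N` to be replaced by its upper bound,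
  -- which tends to `κ`; the ratios themselves need not converge to `κ`.
  exact (hzb N t).2.trans (mul_le_mul_of_nonneg_right (hρ N) (hzb N t).1)
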